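/- Let $\lambda>0$. For $A,B>0$ the $\lambda$-adapted region is $U_{A,B}=\{(x,y)\in\mathbb C^2: |y||x|^\lambda\le A,\ |x|\le 1,\ |y|\le B\}$. A *prepared saddle foliation* with eigenratio $\lambda$ is a pair $(U,\mathcal F)$ where $U\subset\mathbb C^2$ is open, contains some $U_{A,B}$, has simply connected traces $U\cap\{x=0\}$ and $U\cap\{y=0\}$, and $\mathcal F$ is the singular foliation of $U$ defined by a holomorphic $1$-form $x\,dy+\lambda y(1+x^n y\,K(x,y))\,dx$ with an integer $n\ge\max(1,\lfloor\lambda\rfloor)$ and a holomorphic $K$ on $U$ such that $\sup_U|K|\le\varepsilon$ for some $\varepsilon>0$ with $\varepsilon B<1$. Let $\Omega=\{x=1\}$. A *regular transition germ* is a germ of a biholomorphism $R:(\Omega,(1,0))\to(\Sigma,(0,\sigma))$, where $\sigma\ne0$, $|\sigma|\le B'$ for some $A',B'>0$ with $U_{A',B'}\subset U$, and $\Sigma$ is a germ of a holomorphic curve at $(0,\sigma)$ transverse both to $\mathcal F$ and to the fibration $\{x=\mathrm{const}\}$. A *regular transition class* $\mathcal R$ is an orbit of such germs under left composition with the holonomy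 germs of $(U,\mathcal F)$ (between transversals, along paths in leaves). A *loop germ* $\mathbb L=(\mathcal F,\mathcal R)$ with eigenratio $\lambda$ is an equivalence class of triples $(U,\mathcal F,\mathcal R)$, two triples being equivalent if there is a $\lambda$-adapted region contained in both domains on which the foliations coincide and to which the restrictions of the transition classes (the germs with endpoint $(0,\sigma)$ in it) coincide. A *gluing domain* for $\mathbb L$ is an open neighbourhood $W\subset\mathbb C^2$ of $\{|x|\le1,\ y=0\}$ with simply connected traces $W\cap\{x=0\}$ and $W\cap\{y=0\}$ on which $\mathcal F$ and $\mathcal R$ have realizations: the germ $\mathcal F$ extends to a holomorphic singular foliation of $W$ (again denoted $\mathcal F$; it coincides with a representative of $\mathcal F$ on some $\lambda$-adapted region contained in $W$), and there is a germ $R:(\Omega,(1,0))\to(\Sigma,(0,\sigma))$ in $\mathcal R$ whose endpoint $(0,\sigma)$ lies in that region. A *(geometric) realization* of $\mathbb L$ in a complex surface $S$ with a singular holomorphic foliation $\mathcal G$ consists of 1. a biholomorphic map $\Psi:W\to V$ from a gluing domain $W$ for $\mathbb L$ onto an open subset $V\subset S$ with $\Psi(\mathcal F|_W)=\mathcal G|_V$;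 2. a path $\gamma$ contained in a leaf of $\mathcal G$, from $\Psi(1,0)$ to $\Psi(0,\sigma)$, whose holonomy germ from $\Psi(\Omega)$ to $\Psi(\Sigma)$ is $\mathrm{hol}_{\mathcal G,\gamma}=(\Psi|_\Sigma)\circ R\circ(\Psi|_\Omega)^{-1}$, for some germ $R:(\Omega,(1,0))\to(\Sigma,(0,\sigma))$ in $\mathcal R$ realized on $W$ as above. **Proposition.** For every $\lambda>0$, every loop germ $\mathbb L=(\mathcal F,\mathcal R)$ with eigenratio $\lambda$ has a geometric realization in some foliated complex analytic surface $(S,\mathcal G)$, where $S$ is a connected, Hausdorff, second countable complex manifold of dimension $2$ and $\mathcal G$ is a singular holomorphic foliation of $S$ with isolated singularities. -/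

import Mathlib

open scoped Manifold ContDiff Topology unitInterval

noncomputable section

namespace SaddleLoop

/-! ### Singular holomorphic foliations on complex surfaces -/

section Foliations

variable {M : Type} [TopologicalSpace M] [ChartedSpace (ℂ × ℂ) M]

/-- A field of complex subspaces of the tangent spaces of a complex surface `M`. -/
abbrev TangentField (M : Type) [TopologicalSpace M] [ChartedSpace (ℂ × ℂ) M] : Type :=
  ∀ p : M, Submodule ℂ (TangentSpace 𝓘(ℂ, ℂ × ℂ) p)

/-- The differential at `p` of a complex-valued function `u` on `M`. -/
def differential (u : M → ℂ) (p : M) : TangentSpace 𝓘(ℂ, ℂ × ℂ) p →L[ℂ] ℂ :=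
  mfderiv 𝓘(ℂ, ℂ × ℂ) 𝓘(ℂ, ℂ) u p

/-- `u` is holomorphic on the set `N`. -/
def IsHolomorphicOn (u : M → ℂ) (N : Set M) : Prop :=
  MDifferentiableOn 𝓘(ℂ, ℂ × ℂ) 𝓘(ℂ, ℂ) u N

/-- The tangent field `D` is a (saturated) singular holomorphic foliation on the open set `V`:
near each point `p` of `V` it is the field of kernels of a holomorphic differential `1`-form
`a du + b dv` which vanishes nowhere, except possibly at `p`. The singularities are the points
`q` where the form vanishes, that is, where `D q = ⊤`; the leaves are those of the regular
foliation that is obtained by removing the singularities. -/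
def IsFoliationOn (D : TangentField M) (V : Set M) : Prop :=
  IsOpen V ∧ ∀ p ∈ V, ∃ N : Set M, IsOpen N ∧ p ∈ N ∧ N ⊆ V ∧ ∃ a b u v : M → ℂ,
    IsHolomorphicOn a N ∧ IsHolomorphicOn b N ∧ IsHolomorphicOn u N ∧ IsHolomorphicOn v N ∧
    (∀ q ∈ N, D q = (a q • differential u q + b q • differential v q).ker) ∧
    ∀ q ∈ N, q ≠ p → D q ≠ ⊤

/-- `H` is the transverse coordinate of a foliated chart on `N`: a holomorphic submersion
constant along the leaves of `D`. -/
def IsFirstIntegralOn (D : TangentField M) (H : M → ℂ) (N : Set M) : Prop :=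
  IsHolomorphicOn H N ∧ ∀ q ∈ N, differential H q ≠ 0 ∧ D q = (differential H q).ker

/-- `c` is a path in one leaf of the foliation `D` of `V`: it is continuous, and locally it stays
in a plaque of a foliated chart. (So it avoids the singularities.) -/
def IsLeafPath (D : TangentField M) (V : Set M) (c : I → M) : Prop :=
  Continuous c ∧ ∀ t : I, ∃ (N : Set M) (H : M → ℂ), IsOpen N ∧ c t ∈ N ∧ N ⊆ V ∧
    IsFirstIntegralOn D H N ∧ ∀ᶠ s in 𝓝 t, H (c s) = H (c t)

/-- Holonomy along the path `γ`, which lies in a leaf of the foliation `D` of `V`. The germs at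
`0` of `f` and `g` parametrize transversals through the initial point and through the endpoint of
`γ`, and the assertion is that `hol_γ ∘ f = g` as germs at `0`: lifting `γ` to the leaves near it,
starting at `f z`, one arrives at `g z`. Here `Φ · z` is the lifted path, and the lifts depend
continuously on `z`. -/
def HolonomyTransports (D : TangentField M) (V : Set M) (γ : I → M) (f g : ℂ → M) : Prop :=
  ∃ ρ : ℝ, 0 < ρ ∧ ∃ Φ : I → ℂ → M,
    ContinuousOn (fun q : I × ℂ => Φ q.1 q.2) (Set.univ ×ˢ Metric.ball (0 : ℂ) ρ) ∧
    (∀ t, Φ t 0 = γ t) ∧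
    ∀ z ∈ Metric.ball (0 : ℂ) ρ,
      Φ 0 z = f z ∧ Φ 1 z = g z ∧ IsLeafPath D V (fun t => Φ t z)

end Foliations

/-! ### Prepared saddle foliations -/

/-- The `lam`-adapted region `U_{A,B}`. -/
def adaptedRegion (lam A B : ℝ) : Set (ℂ × ℂ) :=
  {p | ‖p.2‖ * ‖p.1‖ ^ lam ≤ A ∧ ‖p.1‖ ≤ 1 ∧ ‖p.2‖ ≤ B}

/-- The kernel at `p = (x, y)` of the `1`-form `x dy + lam y (1 + x ^ n y K(x, y)) dx`. -/
def preparedKernel (lam : ℝ) (n : ℕ) (K : ℂ × ℂ → ℂ) (p : ℂ × ℂ) : Submodule ℂ (ℂ × ℂ) :=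
  (p.1 • ContinuousLinearMap.snd ℂ ℂ ℂ
    + ((lam : ℂ) * p.2 * (1 + p.1 ^ n * p.2 * K p)) • ContinuousLinearMap.fst ℂ ℂ ℂ).ker

/-- A prepared saddle foliation with eigenratio `lam`. Only the values of `fol` on `U` matter. -/
structure PreparedSaddle (lam : ℝ) where
  U : Set (ℂ × ℂ)
  fol : TangentField (ℂ × ℂ)
  isOpen : IsOpen U
  vertical : IsSimplyConnected (U ∩ {p | p.1 = 0})
  horizontal : IsSimplyConnected (U ∩ {p | p.2 = 0})
  prepared : ∃ A B ε : ℝ, 0 < A ∧ 0 < B ∧ 0 < ε ∧ adaptedRegion lam A B ⊆ U ∧ ε * B < 1 ∧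
    ∃ (n : ℕ) (K : ℂ × ℂ → ℂ), 1 ≤ n ∧ ⌊lam⌋₊ ≤ n ∧ DifferentiableOn ℂ K U ∧
      (∀ p ∈ U, ‖K p‖ ≤ ε) ∧ ∀ p ∈ U, fol p = preparedKernel lam n K p

/-- A regular transition germ `R : (Ω, 1) → (Σ, σ)` of a prepared saddle. The fixed transversal
`Ω = {x = 1}` is parametrized by `y ↦ (1, y)`, and `R` is given as the germ at `0` of the
`ℂ²`-valued function `y ↦ R(1, y)`. Its image is the floating transversal `Σ`, a germ of a graph
`{y = α(x)}` at a point `(0, σ)`, `σ ≠ 0`, of the vertical separatrix: `R` is a germ of a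
diffeomorphism onto such a graph exactly if the derivative at `0` of its `x`-component is nonzero.
The last condition says that `σ` is an admissible base-point. -/
def IsRegularTransition {lam : ℝ} (F : PreparedSaddle lam) (R : ℂ → ℂ × ℂ) : Prop :=
  AnalyticAt ℂ R 0 ∧ (R 0).1 = 0 ∧ (R 0).2 ≠ 0 ∧ deriv (fun y => (R y).1) 0 ≠ 0 ∧
  ∃ A B : ℝ, 0 < A ∧ 0 < B ∧ adaptedRegion lam A B ⊆ F.U ∧ ‖(R 0).2‖ ≤ B

/-! ### Loop germs -/

/-- An abstract saddle loop: a prepared saddle with a regular transition class, that is, an orbit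
of regular transition germs under composition with the holonomy germs of the foliation. (Germs are
represented by functions; an orbit contains with a function all functions with the same germ.) -/
structure AbstractLoop (lam : ℝ) extends PreparedSaddle lam where
  trans : Set (ℂ → ℂ × ℂ)
  orbit : ∃ R₀, IsRegularTransition toPreparedSaddle R₀ ∧
    trans = {R | IsRegularTransition toPreparedSaddle R ∧
      ∃ δ : Path (R₀ 0) (R 0), HolonomyTransports fol U δ R₀ R}

/-- Two abstract loops are equivalent if their foliations and their regular transition classes
coincide on some common `lam`-adapted region. -/
def AbstractLoop.Equivalent {lam : ℝ} (l₁ l₂ : AbstractLoop lam) : Prop :=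
  ∃ A B : ℝ, 0 < A ∧ 0 < B ∧ adaptedRegion lam A B ⊆ l₁.U ∩ l₂.U ∧
    (∀ p ∈ adaptedRegion lam A B, l₁.fol p = l₂.fol p) ∧
    ∀ R : ℂ → ℂ × ℂ, R 0 ∈ adaptedRegion lam A B → (R ∈ l₁.trans ↔ R ∈ l₂.trans)

theorem adaptedRegion_mono {lam A A' B B' : ℝ} (hA : A ≤ A') (hB : B ≤ B') :
    adaptedRegion lam A B ⊆ adaptedRegion lam A' B' :=
  fun _ hp => ⟨hp.1.trans hA, hp.2.1, hp.2.2.trans hB⟩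

theorem AbstractLoop.equivalent_equivalence (lam : ℝ) :
    Equivalence (AbstractLoop.Equivalent (lam := lam)) where
  refl l := by
    obtain ⟨A, B, ε, hA, hB, -, hU, -⟩ := l.prepared
    exact ⟨A, B, hA, hB, fun p hp => ⟨hU hp, hU hp⟩, fun _ _ => rfl, fun _ _ => Iff.rfl⟩
  symm := by
    rintro l₁ l₂ ⟨A, B, hA, hB, hU, hF, hR⟩
    exact ⟨A, B, hA, hB, fun p hp => ⟨(hU hp).2, (hU hp).1⟩, fun p hp => (hF p hp).symm,
      fun R h => (hR R h).symm⟩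
  trans := by
    rintro l₁ l₂ l₃ ⟨A, B, hA, hB, hU, hF, hR⟩ ⟨A', B', hA', hB', hU', hF', hR'⟩
    have h : adaptedRegion lam (min A A') (min B B') ⊆ adaptedRegion lam A B :=
      adaptedRegion_mono (min_le_left _ _) (min_le_left _ _)
    have h' : adaptedRegion lam (min A A') (min B B') ⊆ adaptedRegion lam A' B' :=
      adaptedRegion_mono (min_le_right _ _) (min_le_right _ _)
    exact ⟨min A A', min B B', lt_min hA hA', lt_min hB hB',
      fun p hp => ⟨(hU (h hp)).1, (hU' (h' hp)).2⟩,
      fun p hp => (hF p (h hp)).trans (hF' p (h' hp)),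
      fun R hp => (hR R (h hp)).trans (hR' R (h' hp))⟩

instance loopSetoid (lam : ℝ) : Setoid (AbstractLoop lam) :=
  ⟨AbstractLoop.Equivalent, AbstractLoop.equivalent_equivalence lam⟩

/-- Loop germs with eigenratio `lam`. -/
def LoopGerm (lam : ℝ) : Type := Quotient (loopSetoid lam)

/-! ### Geometric realizations -/

/-- A gluing domain `W`, with a holomorphic foliation on `W` whose germ along the adapted regions
is the foliation of the loop, and with a germ `R` of its regular transition class which has its
endpoint in such a region. -/
structure GluingDomain {lam : ℝ} (l : AbstractLoop lam) where
  W : Set (ℂ × ℂ)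
  isOpen : IsOpen W
  disk_subset : {p : ℂ × ℂ | ‖p.1‖ ≤ 1 ∧ p.2 = 0} ⊆ W
  vertical : IsSimplyConnected (W ∩ {p | p.1 = 0})
  horizontal : IsSimplyConnected (W ∩ {p | p.2 = 0})
  fol : TangentField (ℂ × ℂ)
  isFoliation : IsFoliationOn fol W
  R : ℂ → ℂ × ℂ
  mem_trans : R ∈ l.trans
  extends_germ : ∃ A B : ℝ, 0 < A ∧ 0 < B ∧ adaptedRegion lam A B ⊆ l.U ∩ W ∧
    (∀ p ∈ adaptedRegion lam A B, fol p = l.fol p) ∧ R 0 ∈ adaptedRegion lam A B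

/-- A geometric realization of an abstract loop in the surface `S` with the foliation `G`: a
biholomorphic map `Ψ` of a gluing domain `W` onto an open subset of `S`, carrying the foliation of
`W` to `G`, and a path `γ` in a leaf of `G` from `Ψ(1, 0)` to `Ψ(0, σ)` whose holonomy is
`Ψ|_Σ ∘ R ∘ (Ψ|_Ω)⁻¹`. -/
structure Realization {lam : ℝ} (l : AbstractLoop lam) {S : Type} [TopologicalSpace S]
    [ChartedSpace (ℂ × ℂ) S] (G : TangentField S) extends GluingDomain l where
  Ψ : OpenPartialHomeomorph (ℂ × ℂ) S
  source_eq : Ψ.source = W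
  biholomorphic : Ψ.MDifferentiable 𝓘(ℂ, ℂ × ℂ) 𝓘(ℂ, ℂ × ℂ)
  map_fol : ∀ p ∈ W,
    G (Ψ p) = (fol p).map (mfderiv 𝓘(ℂ, ℂ × ℂ) 𝓘(ℂ, ℂ × ℂ) Ψ p).toLinearMap
  γ : Path (Ψ (1, 0)) (Ψ (R 0))
  holonomy : HolonomyTransports G Set.univ γ (fun y => Ψ (1, y)) (fun y => Ψ (R y))

/-- The loop germ `L` has a geometric realization in the foliated surface `(S, G)`. -/
def IsRealizedIn {lam : ℝ} (L : LoopGerm lam) {S : Type} [TopologicalSpace S]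
    [ChartedSpace (ℂ × ℂ) S] (G : TangentField S) : Prop :=
  ∃ l : AbstractLoop lam, (Quotient.mk (loopSetoid lam) l : LoopGerm lam) = L ∧
    Nonempty (Realization l G)

end SaddleLoop

end

/-!
The surface is built by attaching a tube to a neighbourhood `W` of an adapted region `U_{a/2,|σ|}`, where
`R : ({x = 1}, (1, 0)) → (Σ, (0, σ))` is a germ in the given regular transition class. The tube is a
neighbourhood of `[0, ρ] × {0}` in `ℂ²`, foliated by the levels of the second coordinate `z`. One end is
glued to `W` by a flow box `φ₁` of the saddle foliation with `φ₁ (0, z) = (1, z)`, the other end by a flow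
box `φ₂` whose transversal is `Σ`, parametrized by `z ↦ R z`. The leaf `z = const` of the tube then joins
`(1, z)` to `R z`, so the holonomy of the path `[0, ρ] × {0}` is `R` by construction
(`holonomyTransports_tube`, `exists_realization`).

The glued space is Hausdorff because the tube leaves `W` at both ends before its middle is reached: the
time in `φ₁` is `x - 1`, the time in `φ₂` is a multiple of `y - y(R z)`, and `W` is confined to
`|x| < 1 + η`, `|y| < |σ| (1 + η)` with `η` small compared with the size of the boxes
(`exists_tubeGluing`). A compactness argument gives such a `W` on which the foliation is still defined
(`exists_saddleDomain_subset`).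

The analytic input is the existence of holomorphic flow boxes (`exists_flowBox`), that is, the
holomorphic dependence of the solutions of a holomorphic differential equation on complex time and on a
parameter (`exists_holomorphic_flow`). The Picard iterates are holomorphic functions of two variables,
and so is their uniform limit, by Osgood's lemma (`analyticAt_of_separately`). The same lemma shows that
complex differentiable functions of two variables are analytic, which is needed for the complex structure
of the surface and for the regularity of the vector fields.
-/

noncomputable section

namespace SaddleLoop

/-! ### Analyticity of holomorphic functions of two variables -/

open BoundedContinuousFunction in
/-- Osgood's lemma: a continuous function of two complex variables that is holomorphic in each of
them is analytic. By Cauchy's formula in each variable, `f (x, z)` is the value of a continuous linear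
functional at the product of the elements `θ ↦ (ζ₁(θ) - x)⁻¹` and `θ ↦ (ζ₂(θ) - z)⁻¹` of a Banach
algebra of bounded continuous functions, where `ζ₁`, `ζ₂` parametrize two circles; and inversion in a
Banach algebra is analytic. -/
theorem analyticAt_of_separately {F : Type*} [NormedAddCommGroup F] [NormedSpace ℂ F]
    [CompleteSpace F] {f : ℂ × ℂ → F} {U : Set (ℂ × ℂ)} (hU : IsOpen U) (hc : ContinuousOn f U)
    (h₁ : ∀ q ∈ U, DifferentiableAt ℂ (fun x => f (x, q.2)) q.1)
    (h₂ : ∀ q ∈ U, DifferentiableAt ℂ (fun z => f (q.1, z)) q.2) {p : ℂ × ℂ} (hp : p ∈ U) :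
    AnalyticAt ℂ f p := by
  obtain ⟨a, b⟩ := p
  obtain ⟨r, hr, hrU⟩ := Metric.nhds_basis_closedBall.mem_iff.1 (hU.mem_nhds hp)
  rw [← closedBall_prod_same] at hrU
  have hcirc : ∀ (c : ℂ) θ, circleMap c r θ ∈ Metric.closedBall c r := fun c θ =>
    circleMap_mem_closedBall c hr.le θ
  -- the kernel of the double Cauchy integral
  let w : ℝ × ℝ → F := fun q =>
    (((2 * Real.pi * Complex.I : ℂ)⁻¹ * (circleMap 0 r q.1 * Complex.I)) *
      ((2 * Real.pi * Complex.I : ℂ)⁻¹ * (circleMap 0 r q.2 * Complex.I))) •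
        f (circleMap a r q.1, circleMap b r q.2)
  have hw : Continuous w := by
    have hf : Continuous fun q : ℝ × ℝ => f (circleMap a r q.1, circleMap b r q.2) :=
      hc.comp_continuous (by fun_prop) fun q => hrU ⟨hcirc a _, hcirc b _⟩
    exact Continuous.smul (by fun_prop) hf
  have hin : ∀ g : ℝ × ℝ →ᵇ ℂ, Continuous fun θ : ℝ =>
      ∫ θ' in (0:ℝ)..2 * Real.pi, g (θ, θ') • w (θ, θ') := fun g => by
    apply intervalIntegral.continuous_parametric_intervalIntegral_of_continuous'
    simp only [Function.uncurry_def]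
    fun_prop
  let L : (ℝ × ℝ →ᵇ ℂ) →ₗ[ℂ] F := IsLinearMap.mk' (fun g : ℝ × ℝ →ᵇ ℂ =>
    ∫ θ in (0:ℝ)..2 * Real.pi, ∫ θ' in (0:ℝ)..2 * Real.pi, g (θ, θ') • w (θ, θ'))
    { map_add := by
        intro g h
        rw [← intervalIntegral.integral_add ((hin g).intervalIntegrable _ _)
          ((hin h).intervalIntegrable _ _)]
        refine intervalIntegral.integral_congr fun θ _ => ?_
        rw [← intervalIntegral.integral_add (Continuous.intervalIntegrable (by fun_prop) _ _)
          (Continuous.intervalIntegrable (by fun_prop) _ _)]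
        simp [add_smul]
      map_smul := by
        intro c g
        simp [← intervalIntegral.integral_smul, smul_smul] }
  have hK : ∃ C, ∀ θ ∈ Set.uIoc (0:ℝ) (2 * Real.pi), ∀ θ' ∈ Set.uIoc (0:ℝ) (2 * Real.pi),
      ‖w (θ, θ')‖ ≤ C := by
    obtain ⟨C, hC⟩ := ((isCompact_uIcc (a := (0:ℝ)) (b := 2 * Real.pi)).prod
      (isCompact_uIcc (a := (0:ℝ)) (b := 2 * Real.pi))).exists_bound_of_continuousOn
      hw.continuousOn
    exact ⟨C, fun θ h θ' h' => hC (θ, θ') ⟨Set.uIoc_subset_uIcc h, Set.uIoc_subset_uIcc h'⟩⟩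
  obtain ⟨C, hC⟩ := hK
  let Λ : (ℝ × ℝ →ᵇ ℂ) →L[ℂ] F := L.mkContinuous
    (C * |2 * Real.pi - 0| * |2 * Real.pi - 0|) fun g => by
      have : ∀ θ ∈ Set.uIoc (0:ℝ) (2 * Real.pi),
          ‖∫ θ' in (0:ℝ)..2 * Real.pi, g (θ, θ') • w (θ, θ')‖ ≤
            ‖g‖ * C * |2 * Real.pi - 0| := fun θ hθ =>
        intervalIntegral.norm_integral_le_of_norm_le_const fun θ' hθ' => by
          rw [norm_smul]
          exact mul_le_mul (g.norm_coe_le_norm _) (hC θ hθ θ' hθ') (norm_nonneg _) (norm_nonneg _)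
      refine (intervalIntegral.norm_integral_le_of_norm_le_const this).trans_eq (by ring)
  have hΛ : ∀ g, Λ g = ∫ θ in (0:ℝ)..2 * Real.pi, ∫ θ' in (0:ℝ)..2 * Real.pi,
      g (θ, θ') • w (θ, θ') := fun _ => rfl
  let circ (c : ℂ) (s : ℝ × ℝ → ℝ) (hs : Continuous s) : ℝ × ℝ →ᵇ ℂ :=
    BoundedContinuousFunction.ofNormedAddCommGroup (fun q => circleMap c r (s q)) (by fun_prop)
      (‖c‖ + r) fun q => by
        have := hcirc c (s q)
        rw [mem_closedBall_iff_norm] at this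
        linarith [norm_le_norm_add_norm_sub' (circleMap c r (s q)) c]
  have key : ∀ (c : ℂ) (s : ℝ × ℝ → ℝ) (hs : Continuous s),
      IsUnit (circ c s hs - algebraMap ℂ _ c) := by
    intro c s hs
    let g : ℝ × ℝ →ᵇ ℂ := BoundedContinuousFunction.ofNormedAddCommGroup
      (fun q => (circleMap 0 r (s q))⁻¹) (by
        refine Continuous.inv₀ (by fun_prop) fun q => ?_
        exact circleMap_ne_center hr.ne') r⁻¹ fun q => by
        rw [norm_inv, norm_circleMap_zero, abs_of_pos hr]
    refine IsUnit.of_mul_eq_one g ?_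
    ext q
    have : circleMap 0 r (s q) ≠ 0 := circleMap_ne_center hr.ne'
    simp only [g, circ, BoundedContinuousFunction.coe_mul, Pi.mul_apply,
      BoundedContinuousFunction.coe_sub, Pi.sub_apply,
      BoundedContinuousFunction.coe_ofNormedAddCommGroup, BoundedContinuousFunction.coe_one,
      Pi.one_apply, BoundedContinuousFunction.algebraMap_apply]
    rw [smul_eq_mul, mul_one, circleMap_sub_center]
    exact mul_inv_cancel₀ this
  have hA : ∀ (c : ℂ) (s : ℝ × ℝ → ℝ) (hs : Continuous s),
      AnalyticAt ℂ (fun x : ℂ => Ring.inverse (circ c s hs - algebraMap ℂ (ℝ × ℝ →ᵇ ℂ) x)) c :=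
    fun c s hs => (analyticOnNhd_inverse (𝕜 := ℂ) _ (key c s hs)).comp
      (f := fun x : ℂ => circ c s hs - algebraMap ℂ (ℝ × ℝ →ᵇ ℂ) x)
      (analyticAt_const.sub ((Algebra.linearMap ℂ (ℝ × ℝ →ᵇ ℂ)).toContinuousLinearMap.analyticAt c))
  have hev : ∀ (c : ℂ) (s : ℝ × ℝ → ℝ) (hs : Continuous s), ∀ᶠ x in 𝓝 c, ∀ q,
      Ring.inverse (circ c s hs - algebraMap ℂ (ℝ × ℝ →ᵇ ℂ) x) q =
        (circleMap c r (s q) - x)⁻¹ := by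
    intro c s hs
    have hcont : Continuous fun x : ℂ => circ c s hs - algebraMap ℂ (ℝ × ℝ →ᵇ ℂ) x :=
      continuous_const.sub (Algebra.linearMap ℂ (ℝ × ℝ →ᵇ ℂ)).toContinuousLinearMap.continuous
    filter_upwards [hcont.continuousAt.eventually (Units.isOpen.mem_nhds (key c s hs))] with x hx q
    have := congrArg (fun g : ℝ × ℝ →ᵇ ℂ => g q) (Ring.mul_inverse_cancel _ hx)
    simp only [circ, BoundedContinuousFunction.coe_mul, Pi.mul_apply,
      BoundedContinuousFunction.coe_sub, Pi.sub_apply,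
      BoundedContinuousFunction.coe_ofNormedAddCommGroup, BoundedContinuousFunction.coe_one,
      Pi.one_apply, BoundedContinuousFunction.algebraMap_apply, smul_eq_mul, mul_one] at this
    exact eq_inv_of_mul_eq_one_right this
  have hAn : AnalyticAt ℂ (fun q : ℂ × ℂ => Λ
      (Ring.inverse (circ a Prod.fst continuous_fst - algebraMap ℂ (ℝ × ℝ →ᵇ ℂ) q.1) *
        Ring.inverse (circ b Prod.snd continuous_snd - algebraMap ℂ (ℝ × ℝ →ᵇ ℂ) q.2))) (a, b) :=
    (Λ.analyticAt _).comp (((hA a _ continuous_fst).comp_of_eq analyticAt_fst rfl).mul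
      ((hA b _ continuous_snd).comp_of_eq analyticAt_snd rfl))
  refine hAn.congr ?_
  filter_upwards [continuous_fst.continuousAt.eventually (hev a _ continuous_fst),
    continuous_snd.continuousAt.eventually (hev b _ continuous_snd),
    Metric.ball_mem_nhds (a, b) hr] with q hq1 hq2 hq
  rw [← ball_prod_same] at hq
  have c2 : ∀ x ∈ Metric.closedBall a r, (2 * Real.pi * Complex.I : ℂ)⁻¹ •
      (∮ z in C(b, r), (z - q.2)⁻¹ • f (x, z)) = f (x, q.2) := fun x hx =>
    DiffContOnCl.two_pi_i_inv_smul_circleIntegral_sub_inv_smul (f := fun z => f (x, z))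
      (DifferentiableOn.diffContOnCl fun z hz => by
        rw [closure_ball _ hr.ne'] at hz
        exact (h₂ (x, z) (hrU ⟨hx, hz⟩)).differentiableWithinAt) hq.2
  have c1 : (2 * Real.pi * Complex.I : ℂ)⁻¹ •
      (∮ x in C(a, r), (x - q.1)⁻¹ • f (x, q.2)) = f q :=
    DiffContOnCl.two_pi_i_inv_smul_circleIntegral_sub_inv_smul (f := fun x => f (x, q.2))
      (DifferentiableOn.diffContOnCl fun z hz => by
        rw [closure_ball _ hr.ne'] at hz
        exact (h₁ (z, q.2) (hrU ⟨hz, Metric.ball_subset_closedBall hq.2⟩)).differentiableWithinAt)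
      hq.1
  rw [← c1]
  rw [hΛ, circleIntegral, ← intervalIntegral.integral_smul]
  refine intervalIntegral.integral_congr fun θ _ => ?_
  rw [← c2 _ (hcirc a θ), circleIntegral]
  simp only [← intervalIntegral.integral_smul, smul_smul]
  refine intervalIntegral.integral_congr fun θ' _ => ?_
  simp only [BoundedContinuousFunction.coe_mul, Pi.mul_apply, hq1, hq2, deriv_circleMap, w,
    smul_smul]
  congr 1
  ring

/-- Goursat's theorem in two variables. -/
theorem _root_.DifferentiableOn.analyticOnNhd_prod {F : Type*} [NormedAddCommGroup F]
    [NormedSpace ℂ F] [CompleteSpace F] {f : ℂ × ℂ → F} {U : Set (ℂ × ℂ)}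
    (hf : DifferentiableOn ℂ f U) (hU : IsOpen U) : AnalyticOnNhd ℂ f U := fun _ hp =>
  analyticAt_of_separately hU hf.continuousOn
    (fun q hq => ((hf.differentiableAt (hU.mem_nhds hq)).comp q.1
      (f := fun x => (x, q.2)) (by fun_prop) :))
    (fun q hq => ((hf.differentiableAt (hU.mem_nhds hq)).comp q.2
      (f := fun z => (q.1, z)) (by fun_prop) :)) hp

/-! ### Holomorphic dependence of integral curves on time and initial point -/

section Flow

theorem ray_mem_ball {ρ : ℝ} {w : ℂ × ℂ} (hw : w ∈ Metric.ball (0 : ℂ × ℂ) ρ) {t : ℝ}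
    (ht : t ∈ Set.Icc (0 : ℝ) 1) : ((t : ℂ) * w.1, w.2) ∈ Metric.ball (0 : ℂ × ℂ) ρ := by
  rw [mem_ball_zero_iff, Prod.norm_def, max_lt_iff] at hw ⊢
  refine ⟨lt_of_le_of_lt ?_ hw.1, hw.2⟩
  rw [norm_mul, Complex.norm_real, Real.norm_of_nonneg ht.1]
  exact mul_le_of_le_one_left (norm_nonneg _) ht.2

theorem _root_.ContinuousOn.ray {X : Type*} [TopologicalSpace X] {ρ : ℝ} {g : ℂ × ℂ → X}
    (hg : ContinuousOn g (Metric.ball 0 ρ)) {w : ℂ × ℂ} (hw : w ∈ Metric.ball (0 : ℂ × ℂ) ρ) :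
    ContinuousOn (fun t : ℝ => g ((t : ℂ) * w.1, w.2)) (Set.Icc 0 1) :=
  hg.comp (f := fun t : ℝ => ((t : ℂ) * w.1, w.2)) (by fun_prop) fun _ ht => ray_mem_ball hw ht

variable {E : Type*} [NormedAddCommGroup E] [NormedSpace ℂ E]
  [CompleteSpace E]

/-- The mean of a holomorphic function over the segment from `(0, z)` to `(s, z)` is a holomorphic
function of `(s, z)`. -/
theorem _root_.DifferentiableOn.integral_ray {ρ : ℝ} {g : ℂ × ℂ → E}
    (hg : DifferentiableOn ℂ g (Metric.ball 0 ρ)) :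
    DifferentiableOn ℂ (fun w : ℂ × ℂ => ∫ t in (0:ℝ)..1, g ((t : ℂ) * w.1, w.2))
      (Metric.ball 0 ρ) := by
  intro w₀ hw₀
  have hgd : ContinuousOn (fderiv ℂ g) (Metric.ball 0 ρ) :=
    (hg.analyticOnNhd_prod Metric.isOpen_ball).fderiv.continuousOn
  obtain ⟨δ, hδ, hδρ⟩ :=
    Metric.nhds_basis_closedBall.mem_iff.1 (Metric.isOpen_ball.mem_nhds hw₀)
  let A : ℝ → ℂ × ℂ →L[ℂ] ℂ × ℂ := fun t =>
    (t : ℂ) • (ContinuousLinearMap.fst ℂ ℂ ℂ).prod 0 +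
      (0 : ℂ × ℂ →L[ℂ] ℂ).prod (ContinuousLinearMap.snd ℂ ℂ ℂ)
  have hAw : ∀ t w, A t w = ((t : ℂ) * w.1, w.2) := fun t w => by simp [A]
  have hAm : ∀ w ∈ Metric.ball (0 : ℂ × ℂ) ρ, ∀ t ∈ Set.Icc (0:ℝ) 1, A t w ∈ Metric.ball 0 ρ :=
    fun w hw t ht => by rw [hAw]; exact ray_mem_ball hw ht
  have hAc : Continuous A := by fun_prop
  have hu : ∀ t ∈ Set.uIoc (0:ℝ) 1, t ∈ Set.Icc (0:ℝ) 1 := fun t ht => by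
    rw [Set.uIoc_of_le zero_le_one] at ht
    exact ⟨ht.1.le, ht.2⟩
  obtain ⟨C, hC⟩ : ∃ C, ∀ q ∈ Set.Icc (0:ℝ) 1 ×ˢ Metric.closedBall w₀ δ,
      ‖(fderiv ℂ g (A q.1 q.2)).comp (A q.1)‖ ≤ C := by
    refine (isCompact_Icc.prod (isCompact_closedBall w₀ δ)).exists_bound_of_continuousOn ?_
    refine ContinuousOn.clm_comp (hgd.comp (f := fun q : ℝ × (ℂ × ℂ) => A q.1 q.2) ?_ ?_) ?_
    · simp only [hAw]; fun_prop
    · exact fun q hq => hAm _ (hδρ hq.2) _ hq.1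
    · fun_prop
  have hsub : Metric.ball w₀ δ ⊆ Metric.ball 0 ρ := Metric.ball_subset_closedBall.trans hδρ
  have hcont : ∀ w ∈ Metric.ball (0 : ℂ × ℂ) ρ,
      ContinuousOn (fun t : ℝ => g ((t : ℂ) * w.1, w.2)) (Set.Icc 0 1) :=
    fun w hw => hg.continuousOn.ray hw
  refine (intervalIntegral.hasFDerivAt_integral_of_dominated_of_fderiv_le
    (F := fun (w : ℂ × ℂ) (t : ℝ) => g ((t : ℂ) * w.1, w.2))
    (F' := fun w t => (fderiv ℂ g (A t w)).comp (A t)) (bound := fun _ => C)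
    (Metric.ball_mem_nhds w₀ hδ) ?_ ?_ ?_ ?_ ?_ ?_).differentiableAt.differentiableWithinAt
  · filter_upwards [Metric.ball_mem_nhds w₀ hδ] with w hw
    exact ((hcont w (hsub hw)).mono hu).aestronglyMeasurable measurableSet_uIoc
  · refine ContinuousOn.intervalIntegrable ?_
    rw [Set.uIcc_of_le zero_le_one]
    exact hcont w₀ hw₀
  · refine ContinuousOn.aestronglyMeasurable (ContinuousOn.mono ?_ hu) measurableSet_uIoc
    refine ContinuousOn.clm_comp ?_ hAc.continuousOn
    exact hgd.comp (f := fun t : ℝ => A t w₀) (by simp only [hAw]; fun_prop)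
      fun t ht => hAm _ hw₀ t ht
  · exact Filter.Eventually.of_forall fun t ht w hw =>
      hC (t, w) ⟨hu t ht, Metric.ball_subset_closedBall hw⟩
  · exact intervalIntegrable_const
  · refine Filter.Eventually.of_forall fun t ht w hw => ?_
    simp only [← hAw]
    exact (hg.differentiableAt (Metric.isOpen_ball.mem_nhds
      (hAm _ (hsub hw) t (hu t ht)))).hasFDerivAt.comp w (f := A t) (A t).hasFDerivAt

/-- Uniform limits of holomorphic functions of two variables are holomorphic. -/
theorem differentiableOn_of_tendstoUniformlyOn_prod {G : ℕ → ℂ × ℂ → E} {Φ : ℂ × ℂ → E}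
    {U : Set (ℂ × ℂ)} (hU : IsOpen U) (h : TendstoUniformlyOn G Φ Filter.atTop U)
    (hG : ∀ k, DifferentiableOn ℂ (G k) U) : DifferentiableOn ℂ Φ U := by
  intro p hp
  refine (analyticAt_of_separately hU (h.continuousOn (Filter.Frequently.of_forall
    fun k => (hG k).continuousOn)) ?_ ?_ hp).differentiableAt.differentiableWithinAt
  · intro q hq
    have ho : IsOpen ((fun x : ℂ => (x, q.2)) ⁻¹' U) := hU.preimage (by fun_prop)
    exact ((h.comp fun x : ℂ => (x, q.2)).tendstoLocallyUniformlyOn.differentiableOn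
      (Filter.Eventually.of_forall fun k => (hG k).comp (by fun_prop) fun x hx => hx)
      ho).differentiableAt (ho.mem_nhds hq)
  · intro q hq
    have ho : IsOpen ((fun z : ℂ => (q.1, z)) ⁻¹' U) := hU.preimage (by fun_prop)
    exact ((h.comp fun z : ℂ => (q.1, z)).tendstoLocallyUniformlyOn.differentiableOn
      (Filter.Eventually.of_forall fun k => (hG k).comp (by fun_prop) fun x hx => hx)
      ho).differentiableAt (ho.mem_nhds hq)

/-- The Picard iterates of the differential equation `∂Φ/∂s = v(Φ)` with the initial condition
`Φ(0, z) = R z`. -/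
def picardIterate (v : E → E) (R : ℂ → E) (p₀ : E) : ℕ → ℂ × ℂ → E
  | 0, _ => p₀
  | k + 1, w => R w.2 + w.1 • ∫ t in (0:ℝ)..1, v (picardIterate v R p₀ k ((t : ℂ) * w.1, w.2))

/-- The integral curves `s ↦ Φ (s, z)` of a holomorphic vector field depend holomorphically on complex time and
on the parameter of a holomorphic curve of initial points. -/
theorem exists_holomorphic_flow {v : E → E} {R : ℂ → E} (hv : AnalyticAt ℂ v (R 0))
    (hR : AnalyticAt ℂ R 0) : ∃ ρ > 0, ∃ Φ : ℂ × ℂ → E,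
      DifferentiableOn ℂ Φ (Metric.ball 0 ρ) ∧
      (∀ z ∈ Metric.ball (0 : ℂ) ρ, Φ (0, z) = R z) ∧
      ∀ w ∈ Metric.ball (0 : ℂ × ℂ) ρ,
        HasDerivAt (fun s => Φ (s, w.2)) (v (Φ w)) w.1 := by
  set p₀ := R 0 with hp₀
  obtain ⟨C, t, ht, hC⟩ := (hv.contDiffAt (n := 1)).exists_lipschitzOnWith
  have hM : ∀ᶠ p in 𝓝 p₀, ‖v p‖ < ‖v p₀‖ + 1 :=
    hv.continuousAt.norm.eventually_lt_const (by linarith)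
  obtain ⟨r, hr, hrs⟩ := Metric.nhds_basis_closedBall.mem_iff.1
    (Filter.inter_mem ht (Filter.inter_mem hM hv.eventually_analyticAt))
  set M := ‖v p₀‖ + 1 with hMdef
  have hMpos : 0 < M := by positivity
  have hLip : ∀ p ∈ Metric.closedBall p₀ r, ∀ q ∈ Metric.closedBall p₀ r,
      ‖v p - v q‖ ≤ C * ‖p - q‖ := fun p hp q hq => by
    simpa [dist_eq_norm] using hC.dist_le_mul p (hrs hp).1 q (hrs hq).1
  have hMb : ∀ p ∈ Metric.closedBall p₀ r, ‖v p‖ ≤ M := fun p hp => le_of_lt (hrs hp).2.1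
  have hva : ∀ p ∈ Metric.closedBall p₀ r, DifferentiableAt ℂ v p := fun p hp =>
    AnalyticAt.differentiableAt (hrs hp).2.2
  have hRr : ∀ᶠ z in 𝓝 (0 : ℂ), ‖R z - p₀‖ < r / 2 := by
    have := hR.continuousAt.eventually (Metric.ball_mem_nhds (R 0) (half_pos hr))
    simpa [dist_eq_norm] using this
  obtain ⟨ρ₁, hρ₁, hρ₁s⟩ := Metric.eventually_nhds_iff_ball.1 (hRr.and hR.eventually_analyticAt)
  obtain ⟨ρ, hρ, hρ1, hρM, hρC⟩ : ∃ ρ > 0, ρ ≤ ρ₁ ∧ ρ * M ≤ r / 2 ∧ ρ * C ≤ 1 / 2 := by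
    refine ⟨min ρ₁ (min (r / 2 / M) (1 / 2 / (C + 1))), by positivity, min_le_left _ _, ?_, ?_⟩
    · rw [← le_div_iff₀ hMpos]
      exact (min_le_right _ _).trans (min_le_left _ _)
    · have h1 : min ρ₁ (min (r / 2 / M) (1 / 2 / ((C : ℝ) + 1))) ≤ 1 / 2 / (C + 1) :=
        (min_le_right _ _).trans (min_le_right _ _)
      have h0 : (0 : ℝ) < C + 1 := by positivity
      calc _ ≤ 1 / 2 / ((C : ℝ) + 1) * C := by gcongr
        _ ≤ 1 / 2 / ((C : ℝ) + 1) * (C + 1) := by gcongr; linarith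
        _ = 1 / 2 := by field_simp
  have hu : ∀ t ∈ Set.uIoc (0:ℝ) 1, t ∈ Set.Icc (0:ℝ) 1 := fun t ht => by
    rw [Set.uIoc_of_le zero_le_one] at ht
    exact ⟨ht.1.le, ht.2⟩
  set P := Metric.ball (0 : ℂ × ℂ) ρ with hP
  have hw1 : ∀ w ∈ P, ‖w.1‖ < ρ ∧ ‖w.2‖ < ρ := fun w hw => by
    rwa [hP, mem_ball_zero_iff, Prod.norm_def, max_lt_iff] at hw
  have hRP : ∀ w ∈ P, ‖R w.2 - p₀‖ < r / 2 ∧ AnalyticAt ℂ R w.2 := fun w hw =>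
    hρ₁s w.2 (mem_ball_zero_iff.2 ((hw1 w hw).2.trans_le hρ1))
  -- on the polydisc `P` the Picard operator keeps the values in `closedBall p₀ r`, as `ρ * M ≤ r / 2`,
  -- and contracts with the factor `ρ * C ≤ 1 / 2`
  set G := picardIterate v R p₀ with hG
  have hGs : ∀ k w, G (k + 1) w = R w.2 + w.1 • ∫ t in (0:ℝ)..1, v (G k ((t : ℂ) * w.1, w.2)) :=
    fun k w => rfl
  have hinv : ∀ k, DifferentiableOn ℂ (G k) P ∧ Set.MapsTo (G k) P (Metric.closedBall p₀ r) := by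
    intro k
    induction k with
    | zero => exact ⟨differentiableOn_const p₀, fun w _ => Metric.mem_closedBall_self hr.le⟩
    | succ k ih =>
      have hd : DifferentiableOn ℂ (fun w => v (G k w)) P := fun w hw =>
        ((hva _ (ih.2 hw)).comp w ((ih.1 w hw).differentiableAt
          (Metric.isOpen_ball.mem_nhds hw))).differentiableWithinAt
      constructor
      · have h1 : DifferentiableOn ℂ (fun w : ℂ × ℂ => R w.2) P := fun w hw =>
          ((hRP w hw).2.differentiableAt.comp w differentiableAt_snd).differentiableWithinAt
        exact h1.add (differentiableOn_fst.smul hd.integral_ray)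
      · intro w hw
        rw [mem_closedBall_iff_norm, hGs, add_sub_right_comm]
        have h2 : ‖∫ t in (0:ℝ)..1, v (G k ((t : ℂ) * w.1, w.2))‖ ≤ M * |1 - 0| :=
          intervalIntegral.norm_integral_le_of_norm_le_const fun t ht =>
            hMb _ (ih.2 (ray_mem_ball hw (hu t ht)))
        calc _ ≤ ‖R w.2 - p₀‖ + ‖w.1‖ * ‖∫ t in (0:ℝ)..1, v (G k ((t : ℂ) * w.1, w.2))‖ := by
              rw [← norm_smul]; exact norm_add_le _ _
          _ ≤ r / 2 + ρ * (M * |1 - 0|) := by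
              gcongr
              · exact (hRP w hw).1.le
              · exact (hw1 w hw).1.le
          _ ≤ r := by simp only [sub_zero, abs_one, mul_one]; linarith
  have hvd : ∀ {g : ℂ × ℂ → E}, DifferentiableOn ℂ g P → Set.MapsTo g P (Metric.closedBall p₀ r) →
      DifferentiableOn ℂ (fun w => v (g w)) P := fun hg hm w hw =>
    ((hva _ (hm hw)).comp w (hg.differentiableAt
      (Metric.isOpen_ball.mem_nhds hw))).differentiableWithinAt
  have hvi : ∀ k, ∀ w ∈ P, IntervalIntegrable (fun t : ℝ => v (G k ((t : ℂ) * w.1, w.2)))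
      MeasureTheory.volume 0 1 := fun k w hw => by
    refine ContinuousOn.intervalIntegrable ?_
    rw [Set.uIcc_of_le zero_le_one]
    exact (hvd (hinv k).1 (hinv k).2).continuousOn.ray hw
  have hstep : ∀ k, ∀ w ∈ P, dist (G k w) (G (k + 1) w) ≤ r * (1 / 2) ^ k := by
    intro k
    induction k with
    | zero =>
      intro w hw
      rw [dist_comm, pow_zero, mul_one]
      exact (hinv 1).2 hw
    | succ k ih =>
      intro w hw
      rw [dist_eq_norm, hGs, hGs (k + 1), add_sub_add_left_eq_sub, ← smul_sub,
        ← intervalIntegral.integral_sub (hvi k w hw) (hvi (k + 1) w hw), norm_smul]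
      have h2 : ‖∫ t in (0:ℝ)..1, (v (G k ((t : ℂ) * w.1, w.2)) -
          v (G (k + 1) ((t : ℂ) * w.1, w.2)))‖ ≤ (C * (r * (1 / 2) ^ k)) * |1 - 0| :=
        intervalIntegral.norm_integral_le_of_norm_le_const fun t ht => by
          have hm := ray_mem_ball hw (hu t ht)
          refine (hLip _ ((hinv k).2 hm) _ ((hinv (k + 1)).2 hm)).trans ?_
          gcongr
          rw [← dist_eq_norm]
          exact ih _ hm
      calc _ ≤ ρ * ((C * (r * (1 / 2) ^ k)) * |1 - 0|) := by
            gcongr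
            exact (hw1 w hw).1.le
        _ = (ρ * C) * (r * (1 / 2) ^ k) := by simp only [sub_zero, abs_one]; ring
        _ ≤ (1 / 2) * (r * (1 / 2) ^ k) := by gcongr
        _ = _ := by ring
  have hlim : ∀ w, ∃ l, w ∈ P → Filter.Tendsto (fun k => G k w) Filter.atTop (𝓝 l) := by
    intro w
    by_cases hw : w ∈ P
    · obtain ⟨l, hl⟩ := cauchySeq_tendsto_of_complete
        (cauchySeq_of_le_geometric (1 / 2) r (by norm_num) fun k => hstep k w hw)
      exact ⟨l, fun _ => hl⟩
    · exact ⟨0, fun h => absurd h hw⟩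
  choose Φ hΦ using hlim
  have hunif : TendstoUniformlyOn G Φ Filter.atTop P := by
    rw [Metric.tendstoUniformlyOn_iff]
    intro ε hε
    have h0 : Filter.Tendsto (fun k : ℕ => r * (1 / 2 : ℝ) ^ k / (1 - 1 / 2)) Filter.atTop (𝓝 0) := by
      simpa using ((tendsto_pow_atTop_nhds_zero_of_lt_one (r := (1 / 2 : ℝ)) (by norm_num)
        (by norm_num)).const_mul r).div_const (1 - 1 / 2)
    filter_upwards [h0.eventually_lt_const hε] with k hk w hw
    rw [dist_comm]
    exact (dist_le_of_le_geometric_of_tendsto (1 / 2) r (by norm_num)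
      (fun k => hstep k w hw) (hΦ w hw) k).trans_lt hk
  have hΦd : DifferentiableOn ℂ Φ P :=
    differentiableOn_of_tendstoUniformlyOn_prod Metric.isOpen_ball hunif fun k => (hinv k).1
  have hΦm : Set.MapsTo Φ P (Metric.closedBall p₀ r) := fun w hw =>
    Metric.isClosed_closedBall.mem_of_tendsto (hΦ w hw)
      (Filter.Eventually.of_forall fun k => (hinv k).2 hw)
  have hint : ∀ w ∈ P, Φ w = R w.2 + w.1 • ∫ t in (0:ℝ)..1, v (Φ ((t : ℂ) * w.1, w.2)) := by
    intro w hw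
    refine tendsto_nhds_unique ((hΦ w hw).comp (Filter.tendsto_add_atTop_nat 1)) ?_
    simp only [Function.comp_def, hGs]
    refine tendsto_const_nhds.add (Filter.Tendsto.const_smul ?_ _)
    refine intervalIntegral.tendsto_integral_filter_of_dominated_convergence (fun _ => M)
      (Filter.Eventually.of_forall fun k => ?_) (Filter.Eventually.of_forall fun k =>
        Filter.Eventually.of_forall fun t ht => hMb _ ((hinv k).2 (ray_mem_ball hw (hu t ht))))
      intervalIntegrable_const (Filter.Eventually.of_forall fun t ht => ?_)
    · exact (((hvd (hinv k).1 (hinv k).2).continuousOn.ray hw).mono hu).aestronglyMeasurable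
        measurableSet_uIoc
    · have hm := ray_mem_ball hw (hu t ht)
      exact (hva _ (hΦm hm)).continuousAt.tendsto.comp (hΦ _ hm)
  refine ⟨ρ, hρ, Φ, hΦd, fun z hz => ?_, fun w hw => ?_⟩
  · have hm : ((0 : ℂ), z) ∈ P := by
      rw [mem_ball_zero_iff] at hz
      rw [hP, mem_ball_zero_iff, Prod.norm_def, max_lt_iff]
      exact ⟨by simpa using hρ, hz⟩
    simpa using hint _ hm
  · have hmem : ∀ s ∈ Metric.ball (0 : ℂ) ρ, (s, w.2) ∈ P := fun s hs => by
      rw [hP, mem_ball_zero_iff, Prod.norm_def, max_lt_iff]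
      exact ⟨mem_ball_zero_iff.1 hs, (hw1 w hw).2⟩
    have hd1 : DifferentiableOn ℂ (fun s => v (Φ (s, w.2))) (Metric.ball 0 ρ) :=
      (hvd hΦd hΦm).comp (f := fun s : ℂ => (s, w.2)) (by fun_prop) hmem
    -- the integral along a ray is the increment of a primitive
    obtain ⟨g, hg⟩ := hd1.isExactOn_ball
    have heq : ∀ s ∈ Metric.ball (0 : ℂ) ρ, Φ (s, w.2) = R w.2 + (g s - g 0) := by
      intro s hs
      have hray : ∀ t ∈ Set.uIcc (0:ℝ) 1, (t : ℂ) * s ∈ Metric.ball (0 : ℂ) ρ := fun t ht => by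
        rw [Set.uIcc_of_le zero_le_one] at ht
        have := (hw1 _ (ray_mem_ball (hmem s hs) ht)).1
        exact mem_ball_zero_iff.2 this
      have h3 := intervalIntegral.integral_eq_sub_of_hasDerivAt (a := 0) (b := 1)
        (f := fun t : ℝ => g ((t : ℂ) * s)) (f' := fun t : ℝ => s • v (Φ ((t : ℂ) * s, w.2)))
        (fun t ht => by
          have h4 : HasDerivAt (fun t : ℝ => (t : ℂ) * s) s t := by
            simpa using (Complex.ofRealCLM.hasDerivAt (x := t)).mul_const s
          exact (hg _ (hray t ht)).scomp t h4)
        (by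
          refine ContinuousOn.intervalIntegrable (continuousOn_const.smul ?_)
          rw [Set.uIcc_of_le zero_le_one]
          exact (hvd hΦd hΦm).continuousOn.ray (hmem s hs))
      rw [intervalIntegral.integral_smul] at h3
      rw [hint _ (hmem s hs)]
      simpa using h3
    have hwm : w.1 ∈ Metric.ball (0 : ℂ) ρ := mem_ball_zero_iff.2 (hw1 w hw).1
    refine (((hg _ hwm).sub_const (g 0)).const_add (R w.2)).congr_of_eventuallyEq ?_
    filter_upwards [Metric.isOpen_ball.mem_nhds hwm] with s hs
    exact heq s hs

end Flow

/-! ### Flow boxes -/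

/-- A holomorphic flow box: the time `s` and the parameter `z` of a curve of initial points,
transverse to the vector field `v`, are local coordinates. -/
theorem exists_flowBox {v : ℂ × ℂ → ℂ × ℂ} {R : ℂ → ℂ × ℂ} (hv : AnalyticAt ℂ v (R 0))
    (hR : AnalyticAt ℂ R 0)
    (hdet : (v (R 0)).1 * (deriv R 0).2 - (v (R 0)).2 * (deriv R 0).1 ≠ 0)
    {O : Set (ℂ × ℂ)} (hO : O ∈ 𝓝 (R 0)) :
    ∃ (φ : OpenPartialHomeomorph (ℂ × ℂ) (ℂ × ℂ)) (ρ : ℝ), 0 < ρ ∧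
      φ.source = Metric.ball 0 ρ ∧ φ.target ⊆ O ∧ DifferentiableOn ℂ φ φ.source ∧
      DifferentiableOn ℂ φ.symm φ.target ∧ (∀ z ∈ Metric.ball (0 : ℂ) ρ, φ (0, z) = R z) ∧
      ∀ w ∈ Metric.ball (0 : ℂ × ℂ) ρ, HasDerivAt (fun s => φ (s, w.2)) (v (φ w)) w.1 := by
  obtain ⟨ρ₁, hρ₁, Φ, hΦ, hΦ0, hΦs⟩ := exists_holomorphic_flow hv hR
  have h0 : (0 : ℂ × ℂ) ∈ Metric.ball (0 : ℂ × ℂ) ρ₁ := Metric.mem_ball_self hρ₁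
  have hΦ00 : Φ 0 = R 0 := hΦ0 0 (Metric.mem_ball_self hρ₁)
  have han : AnalyticAt ℂ Φ 0 := hΦ.analyticOnNhd_prod Metric.isOpen_ball 0 h0
  set L := fderiv ℂ Φ 0
  have hL : HasFDerivAt Φ L 0 := han.differentiableAt.hasFDerivAt
  have hL1 : L (1, 0) = v (R 0) := by
    have h1 : HasDerivAt (fun s : ℂ => Φ (s, 0)) (L (1, 0)) 0 :=
      HasFDerivAt.comp_hasDerivAt (f := fun s : ℂ => ((s, 0) : ℂ × ℂ)) (l := Φ)
        0 hL ((hasDerivAt_id _).prodMk (hasDerivAt_const _ _))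
    rw [← hΦ00]
    exact h1.unique (hΦs 0 h0)
  have hL2 : L (0, 1) = deriv R 0 := by
    have h1 : HasDerivAt (fun z : ℂ => Φ (0, z)) (L (0, 1)) 0 :=
      HasFDerivAt.comp_hasDerivAt (f := fun z : ℂ => ((0, z) : ℂ × ℂ)) (l := Φ)
        0 hL ((hasDerivAt_const _ _).prodMk (hasDerivAt_id _))
    refine h1.unique (hR.differentiableAt.hasDerivAt.congr_of_eventuallyEq ?_)
    filter_upwards [Metric.ball_mem_nhds (0 : ℂ) hρ₁] with z hz using hΦ0 z hz
  have hinj : Function.Injective (L : ℂ × ℂ →ₗ[ℂ] ℂ × ℂ) := by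
    rw [injective_iff_map_eq_zero]
    intro x hx
    have hx' : x.1 • v (R 0) + x.2 • deriv R 0 = 0 := by
      rw [← hL1, ← hL2, ← map_smul, ← map_smul, ← map_add]
      simpa using hx
    have e1 := congrArg Prod.fst hx'
    have e2 := congrArg Prod.snd hx'
    simp only [Prod.fst_add, Prod.smul_fst, smul_eq_mul, Prod.fst_zero, Prod.snd_add,
      Prod.smul_snd, Prod.snd_zero] at e1 e2
    refine Prod.ext (mul_left_cancel₀ hdet ?_) (mul_left_cancel₀ hdet ?_)
    · simp only [Prod.fst_zero]
      linear_combination (deriv R 0).2 * e1 - (deriv R 0).1 * e2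
    · simp only [Prod.snd_zero]
      linear_combination (v (R 0)).1 * e2 - (v (R 0)).2 * e1
  let L' : (ℂ × ℂ) ≃L[ℂ] ℂ × ℂ :=
    (LinearEquiv.ofInjectiveEndo (L : ℂ × ℂ →ₗ[ℂ] ℂ × ℂ) hinj).toContinuousLinearEquiv
  have hL' : HasFDerivAt Φ (L' : ℂ × ℂ →L[ℂ] ℂ × ℂ) 0 := hL
  have hc : ContDiffAt ℂ ω Φ 0 := han.contDiffAt
  have hω : (ω : WithTop ℕ∞) ≠ 0 := by simp
  set φ₀ := hc.toOpenPartialHomeomorph Φ hL' hω with hφ₀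
  have hφ₀c : (φ₀ : ℂ × ℂ → ℂ × ℂ) = Φ := rfl
  have hsa : ∀ᶠ p in 𝓝 (Φ 0), AnalyticAt ℂ φ₀.symm p :=
    (hc.to_localInverse hL' hω).analyticAt.eventually_analyticAt
  have hV : ∀ᶠ p in 𝓝 (Φ 0), p ∈ O ∧ AnalyticAt ℂ φ₀.symm p := by
    refine Filter.Eventually.and ?_ hsa
    rw [hΦ00]
    exact hO
  obtain ⟨ρ, hρ, hρs⟩ := Metric.eventually_nhds_iff_ball.1
    ((han.continuousAt.eventually hV).and ((φ₀.open_source.eventually_mem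
      (hc.mem_toOpenPartialHomeomorph_source hL' hω)).and
        (Metric.isOpen_ball.eventually_mem h0)))
  have hsrc : (φ₀.restrOpen _ (Metric.isOpen_ball (x := (0 : ℂ × ℂ)) (ε := ρ))).source =
      Metric.ball 0 ρ := by
    rw [φ₀.restrOpen_source]
    exact Set.inter_eq_right.2 fun w hw => (hρs w hw).2.1
  have hsy : ∀ p ∈ (φ₀.restrOpen _ (Metric.isOpen_ball (x := (0 : ℂ × ℂ)) (ε := ρ))).target,
      p ∈ O ∧ AnalyticAt ℂ φ₀.symm p := fun p hp => by
    have h1 := OpenPartialHomeomorph.map_target _ hp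
    have h2 := OpenPartialHomeomorph.right_inv _ hp
    rw [hsrc] at h1
    have h3 := (hρs _ h1).1
    have h4 : Φ ((φ₀.restrOpen _ (Metric.isOpen_ball (x := (0 : ℂ × ℂ)) (ε := ρ))).symm p) = p := h2
    rwa [h4] at h3
  refine ⟨φ₀.restrOpen _ (Metric.isOpen_ball (x := (0 : ℂ × ℂ)) (ε := ρ)), ρ, hρ, hsrc,
    fun p hp => (hsy p hp).1, ?_, fun p hp => (hsy p hp).2.differentiableAt.differentiableWithinAt,
    fun z hz => hΦ0 z ?_, fun w hw => hΦs w (hρs w hw).2.2⟩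
  · rw [hsrc]
    exact hΦ.mono fun w hw => (hρs w hw).2.2
  · have h1 : ((0 : ℂ), z) ∈ Metric.ball (0 : ℂ × ℂ) ρ := by
      rw [mem_ball_zero_iff] at hz ⊢
      simpa [Prod.norm_def, hρ] using hz
    have h2 := (hρs _ h1).2.2
    rw [mem_ball_zero_iff, Prod.norm_def, max_lt_iff] at h2
    exact mem_ball_zero_iff.2 h2.2

theorem ker_eq_ker_of_common_vector {α β : ℂ × ℂ →L[ℂ] ℂ} {v : ℂ × ℂ} (hv : v ≠ 0) (hα : α ≠ 0)
    (hβ : β ≠ 0) (hαv : α v = 0) (hβv : β v = 0) : α.ker = β.ker := by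
  have key : ∀ {γ : ℂ × ℂ →L[ℂ] ℂ}, γ ≠ 0 → γ v = 0 → ∀ x, γ x = 0 ↔ x.1 * v.2 - x.2 * v.1 = 0 := by
    intro γ hγ hγv x
    have e : ∀ y : ℂ × ℂ, γ y = y.1 * γ (1, 0) + y.2 * γ (0, 1) := fun y => by
      have : y = y.1 • ((1, 0) : ℂ × ℂ) + y.2 • ((0, 1) : ℂ × ℂ) := by ext <;> simp
      conv_lhs => rw [this, map_add, map_smul, map_smul]
      rfl
    have hne : γ (1, 0) ≠ 0 ∨ γ (0, 1) ≠ 0 := by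
      by_contra! h
      exact hγ (ContinuousLinearMap.ext fun y => by rw [e, h.1, h.2]; simp)
    have hv' : v.1 ≠ 0 ∨ v.2 ≠ 0 := by
      by_contra! h
      exact hv (Prod.ext h.1 h.2)
    rw [e] at hγv ⊢
    generalize γ (1, 0) = a at *
    generalize γ (0, 1) = b at *
    constructor
    · intro h
      rcases hne with h' | h'
      · exact mul_left_cancel₀ h' (by linear_combination v.2 * h - x.2 * hγv)
      · exact mul_left_cancel₀ h' (by linear_combination x.1 * hγv - v.1 * h)
    · intro h
      rcases hv' with h' | h'
      · exact mul_left_cancel₀ h' (by linear_combination x.1 * hγv - b * h)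
      · exact mul_left_cancel₀ h' (by linear_combination x.2 * hγv + a * h)
  ext x
  exact (key hα hαv x).trans (key hβ hβv x).symm

/-- The parameter `z` of a flow box of `v` is a first integral of the foliation `ker α`, if `v` is
tangent to it. -/
theorem isFirstIntegralOn_flowBox {D : TangentField (ℂ × ℂ)}
    {φ : OpenPartialHomeomorph (ℂ × ℂ) (ℂ × ℂ)} {v : ℂ × ℂ → ℂ × ℂ}
    {α : ℂ × ℂ → ℂ × ℂ →L[ℂ] ℂ} (hφ : DifferentiableOn ℂ φ φ.source)
    (hφs : DifferentiableOn ℂ φ.symm φ.target)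
    (hv : ∀ w ∈ φ.source, HasDerivAt (fun s => φ (s, w.2)) (v (φ w)) w.1)
    (hD : ∀ p ∈ φ.target, D p = (α p).ker) (hα : ∀ p ∈ φ.target, α p ≠ 0)
    (hαv : ∀ p ∈ φ.target, α p (v p) = 0) :
    IsFirstIntegralOn D (fun p => (φ.symm p).2) φ.target := by
  refine ⟨mdifferentiableOn_iff_differentiableOn.2 hφs.snd, fun p hp => ?_⟩
  have hd : differential (fun p => (φ.symm p).2) p = fderiv ℂ (fun p => (φ.symm p).2) p :=
    mfderiv_eq_fderiv
  have hs := (hφs.differentiableAt (φ.open_target.mem_nhds hp)).hasFDerivAt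
  have hw := φ.map_target hp
  have hf := (hφ.differentiableAt (φ.open_source.mem_nhds hw)).hasFDerivAt
  set A := fderiv ℂ φ.symm p
  set B := fderiv ℂ φ (φ.symm p)
  have hAB : A.comp B = ContinuousLinearMap.id ℂ (ℂ × ℂ) := by
    have h1 : HasFDerivAt (φ.symm ∘ φ) (A.comp B) (φ.symm p) :=
      HasFDerivAt.comp _ (by rwa [φ.right_inv hp]) hf
    refine h1.unique ((hasFDerivAt_id _).congr_of_eventuallyEq ?_)
    filter_upwards [φ.open_source.mem_nhds hw] with q hq using φ.left_inv hq
  have hAB' : ∀ x, A (B x) = x := fun x => by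
    simpa using congrArg (fun T : ℂ × ℂ →L[ℂ] ℂ × ℂ => T x) hAB
  have hBv : B (1, 0) = v p := by
    have h1 : HasDerivAt (fun s : ℂ => φ (s, (φ.symm p).2)) (B (1, 0)) (φ.symm p).1 :=
      HasFDerivAt.comp_hasDerivAt
        (f := fun s : ℂ => ((s, (φ.symm p).2) : ℂ × ℂ)) (l := φ)
        _ hf ((hasDerivAt_id _).prodMk (hasDerivAt_const _ _))
    have h2 := hv _ hw
    rw [φ.right_inv hp] at h2
    exact h1.unique h2
  have hfd : fderiv ℂ (fun p => (φ.symm p).2) p = (ContinuousLinearMap.snd ℂ ℂ ℂ).comp A :=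
    hs.snd.fderiv
  have hne : (ContinuousLinearMap.snd ℂ ℂ ℂ).comp A ≠ 0 := fun h => by
    have := congrArg (fun T : ℂ × ℂ →L[ℂ] ℂ => T (B (0, 1))) h
    simp [hAB'] at this
  have hvne : v p ≠ 0 := fun h => by
    have := hAB' (1, 0)
    rw [hBv, h, map_zero] at this
    exact one_ne_zero (congrArg Prod.fst this).symm
  rw [hd, hfd]
  refine ⟨hne, ?_⟩
  rw [hD p hp]
  refine ker_eq_ker_of_common_vector hvne (hα p hp) hne (hαv p hp) ?_
  rw [← hBv]
  simp [hAB']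

/-! ### Gluing topological spaces -/

section Gluing

variable {E : Type} [TopologicalSpace E]

/-- An open embedding of the subspace `W` of `E`, as a partial homeomorphism of `E`. -/
theorem exists_openPartialHomeomorph_of_subtype {S : Type} [TopologicalSpace S] {W : Set E}
    (hW : IsOpen W) (hne : W.Nonempty) {i : W → S} (hi : Topology.IsOpenEmbedding i) :
    ∃ e : OpenPartialHomeomorph E S, e.source = W ∧ e.target = Set.range i ∧ ∀ w : W, e w = i w := by
  have : Nonempty W := hne.to_subtype
  let c := hW.isOpenEmbedding_subtypeVal.toOpenPartialHomeomorph ((↑) : W → E)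
  refine ⟨c.symm.trans (hi.toOpenPartialHomeomorph i), ?_, ?_, fun w => ?_⟩
  · simp [c]
  · simp [c]
  · exact congrArg i (c.left_inv (Set.mem_univ w))

/-- Two open subsets `W` and `T` of a space are glued along a homeomorphism `τ` from an open subset
of `T` to an open subset of `W`. The hypothesis `hsep` says that the graph of `τ` is closed in
`T × W`, so that the result is Hausdorff. -/
theorem exists_glued_space [T2Space E] [SecondCountableTopology E] {W T : Set E} (hW : IsOpen W)
    (hT : IsOpen T) (hWn : W.Nonempty) (hTn : T.Nonempty) (τ : OpenPartialHomeomorph E E)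
    (hs : τ.source ⊆ T) (ht : τ.target ⊆ W)
    (hsep : ∀ t ∈ T, t ∉ τ.source → ∀ w ∈ W, ∃ N M : Set E, IsOpen N ∧ IsOpen M ∧ t ∈ N ∧ w ∈ M ∧
      ∀ t' ∈ N ∩ τ.source, τ t' ∉ M) :
    ∃ (S : Type) (_ : TopologicalSpace S) (e₁ e₂ : OpenPartialHomeomorph E S),
      T2Space S ∧ SecondCountableTopology S ∧ e₁.source = W ∧ e₂.source = T ∧
      e₁.target ∪ e₂.target = Set.univ ∧ (∀ t ∈ τ.source, e₂ t = e₁ (τ t)) ∧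
      ∀ t ∈ T, e₂ t ∈ e₁.target → t ∈ τ.source := by
  classical
  -- the normal form of a point of the disjoint union
  let nf : W ⊕ T → W ⊕ T := Sum.elim Sum.inl fun t =>
    if h : (t : E) ∈ τ.source then Sum.inl ⟨τ t, ht (τ.map_source h)⟩ else Sum.inr t
  let r : Setoid (W ⊕ T) := Setoid.ker nf
  let π : W ⊕ T → Quotient r := Quotient.mk r
  have hπ : ∀ a b, π a = π b ↔ nf a = nf b := fun a b => Quotient.eq
  have hin : ∀ t : T, ∀ h : (t : E) ∈ τ.source,
      nf (Sum.inr t) = Sum.inl ⟨τ t, ht (τ.map_source h)⟩ := fun t h => by simp [nf, h]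
  have hout : ∀ t : T, (t : E) ∉ τ.source → nf (Sum.inr t) = Sum.inr t := fun t h => by
    simp [nf, h]
  have h11 : ∀ w w' : W, π (Sum.inl w) = π (Sum.inl w') ↔ w = w' := fun w w' => by
    rw [hπ]; exact Sum.inl_injective.eq_iff
  have h21 : ∀ (t : T) (w : W), π (Sum.inr t) = π (Sum.inl w) ↔
      (t : E) ∈ τ.source ∧ τ t = w := fun t w => by
    rw [hπ]
    by_cases h : (t : E) ∈ τ.source
    · rw [hin t h]
      simp [nf, h, Subtype.ext_iff]
    · rw [hout t h]
      simp [nf, h]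
  have h22 : ∀ t t' : T, π (Sum.inr t) = π (Sum.inr t') ↔ t = t' := fun t t' => by
    rw [hπ]
    by_cases h : (t : E) ∈ τ.source <;> by_cases h' : (t' : E) ∈ τ.source
    · rw [hin t h, hin t' h', Sum.inl_injective.eq_iff, Subtype.mk.injEq, τ.injOn.eq_iff h h',
        Subtype.ext_iff]
    · rw [hin t h, hout t' h']
      exact ⟨fun H => by simp at H, fun H => absurd (H ▸ h) h'⟩
    · rw [hout t h, hin t' h']
      exact ⟨fun H => by simp at H, fun H => absurd (H ▸ h') h⟩
    · rw [hout t h, hout t' h', Sum.inr_injective.eq_iff]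
  have hπc : Continuous π := continuous_quotient_mk'
  have hπo : IsOpenMap π := by
    intro O hO
    rw [isOpen_sum_iff] at hO
    have ho1 := hW.isOpenMap_subtype_val _ hO.1
    have ho2 := hT.isOpenMap_subtype_val _ hO.2
    refine isQuotientMap_quotient_mk'.isOpen_preimage.1 (isOpen_sum_iff.2 ⟨?_, ?_⟩)
    · have : Sum.inl ⁻¹' (π ⁻¹' (π '' O)) = Sum.inl ⁻¹' O ∪
          Subtype.val ⁻¹' (τ '' (τ.source ∩ Subtype.val '' (Sum.inr ⁻¹' O))) := by
        ext w
        simp only [Set.mem_preimage, Set.mem_image, Set.mem_union, Set.mem_inter_iff]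
        constructor
        · rintro ⟨a | a, ha, he⟩
          · exact Or.inl ((h11 _ _).1 he ▸ ha)
          · obtain ⟨h, h'⟩ := (h21 _ _).1 he
            exact Or.inr ⟨a, ⟨h, a, ha, rfl⟩, h'⟩
        · rintro (h | ⟨_, ⟨h, a, ha, rfl⟩, h'⟩)
          · exact ⟨_, h, rfl⟩
          · exact ⟨Sum.inr a, ha, (h21 _ _).2 ⟨h, h'⟩⟩
      change IsOpen (Sum.inl ⁻¹' (π ⁻¹' (π '' O)))
      rw [this]
      exact hO.1.union ((τ.isOpen_image_source_inter ho2).preimage continuous_subtype_val)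
    · have : Sum.inr ⁻¹' (π ⁻¹' (π '' O)) = Sum.inr ⁻¹' O ∪
          Subtype.val ⁻¹' (τ.source ∩ τ ⁻¹' (Subtype.val '' (Sum.inl ⁻¹' O))) := by
        ext t
        simp only [Set.mem_preimage, Set.mem_image, Set.mem_union, Set.mem_inter_iff]
        constructor
        · rintro ⟨a | a, ha, he⟩
          · obtain ⟨h, h'⟩ := (h21 _ _).1 he.symm
            exact Or.inr ⟨h, a, ha, h'.symm⟩
          · exact Or.inl ((h22 _ _).1 he ▸ ha)
        · rintro (h | ⟨h, a, ha, h'⟩)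
          · exact ⟨_, h, rfl⟩
          · exact ⟨Sum.inl a, ha, ((h21 _ _).2 ⟨h, h'.symm⟩).symm⟩
      change IsOpen (Sum.inr ⁻¹' (π ⁻¹' (π '' O)))
      rw [this]
      exact hO.2.union ((τ.isOpen_inter_preimage ho1).preimage continuous_subtype_val)
  have hi : Topology.IsOpenEmbedding fun w : W => π (Sum.inl w) :=
    .of_continuous_injective_isOpenMap (hπc.comp continuous_inl)
      (fun w w' h => (h11 w w').1 h) (hπo.comp isOpenMap_inl)
  have hj : Topology.IsOpenEmbedding fun t : T => π (Sum.inr t) :=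
    .of_continuous_injective_isOpenMap (hπc.comp continuous_inr)
      (fun t t' h => (h22 t t').1 h) (hπo.comp isOpenMap_inr)
  obtain ⟨e₁, hs₁, ht₁, he₁⟩ := exists_openPartialHomeomorph_of_subtype hW hWn hi
  obtain ⟨e₂, hs₂, ht₂, he₂⟩ := exists_openPartialHomeomorph_of_subtype hT hTn hj
  have hsc : SecondCountableTopology (Quotient r) :=
    TopologicalSpace.Quotient.secondCountableTopology hπo
  have hsep1 : ∀ w w' : W, w ≠ w' → ∃ A B : Set (Quotient r), IsOpen A ∧ IsOpen B ∧
      π (Sum.inl w) ∈ A ∧ π (Sum.inl w') ∈ B ∧ Disjoint A B := fun w w' h => by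
    obtain ⟨A, B, hA, hB, hwA, hwB, hAB⟩ := t2_separation h
    exact ⟨_, _, hi.isOpenMap _ hA, hi.isOpenMap _ hB, ⟨w, hwA, rfl⟩, ⟨w', hwB, rfl⟩,
      (Set.disjoint_image_iff hi.injective).2 hAB⟩
  have hsep2 : ∀ t t' : T, t ≠ t' → ∃ A B : Set (Quotient r), IsOpen A ∧ IsOpen B ∧
      π (Sum.inr t) ∈ A ∧ π (Sum.inr t') ∈ B ∧ Disjoint A B := fun w w' h => by
    obtain ⟨A, B, hA, hB, hwA, hwB, hAB⟩ := t2_separation h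
    exact ⟨_, _, hj.isOpenMap _ hA, hj.isOpenMap _ hB, ⟨w, hwA, rfl⟩, ⟨w', hwB, rfl⟩,
      (Set.disjoint_image_iff hj.injective).2 hAB⟩
  have hsep3 : ∀ (t : T) (w : W), π (Sum.inr t) ≠ π (Sum.inl w) →
      ∃ A B : Set (Quotient r), IsOpen A ∧ IsOpen B ∧
      π (Sum.inr t) ∈ A ∧ π (Sum.inl w) ∈ B ∧ Disjoint A B := fun t w h => by
    by_cases hts : (t : E) ∈ τ.source
    · have he : π (Sum.inr t) = π (Sum.inl ⟨τ t, ht (τ.map_source hts)⟩) := (h21 _ _).2 ⟨hts, rfl⟩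
      rw [he] at h ⊢
      exact hsep1 _ _ fun h' => h ((h11 _ _).2 h')
    · obtain ⟨N, M, hN, hM, htN, hwM, hNM⟩ := hsep t t.2 hts w w.2
      refine ⟨_, _, hj.isOpenMap _ (hN.preimage continuous_subtype_val),
        hi.isOpenMap _ (hM.preimage continuous_subtype_val), ⟨t, htN, rfl⟩, ⟨w, hwM, rfl⟩, ?_⟩
      rw [Set.disjoint_left]
      rintro _ ⟨t', ht', rfl⟩ ⟨w', hw', he⟩
      obtain ⟨h1, h2⟩ := (h21 _ _).1 he.symm
      exact hNM t' ⟨ht', h1⟩ (h2 ▸ hw')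
  refine ⟨Quotient r, inferInstance, e₁, e₂, ⟨?_⟩, hsc, hs₁, hs₂, ?_, ?_, ?_⟩
  · intro a b hab
    induction a using Quotient.inductionOn with | h a => ?_
    induction b using Quotient.inductionOn with | h b => ?_
    rcases a with a | a <;> rcases b with b | b
    · exact hsep1 a b fun h => hab (by rw [h])
    · obtain ⟨A, B, hA, hB, h1, h2, h3⟩ := hsep3 b a hab.symm
      exact ⟨B, A, hB, hA, h2, h1, h3.symm⟩
    · exact hsep3 a b hab
    · exact hsep2 a b fun h => hab (by rw [h])
  · rw [ht₁, ht₂, Set.eq_univ_iff_forall]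
    intro a
    induction a using Quotient.inductionOn with | h a => ?_
    rcases a with a | a
    · exact Or.inl ⟨a, rfl⟩
    · exact Or.inr ⟨a, rfl⟩
  · intro t h
    exact (he₂ ⟨t, hs h⟩).trans (((h21 ⟨t, hs h⟩ ⟨τ t, ht (τ.map_source h)⟩).2 ⟨h, rfl⟩).trans
      (he₁ ⟨τ t, ht (τ.map_source h)⟩).symm)
  · intro t h h'
    rw [ht₁] at h'
    obtain ⟨w, hw⟩ := h'
    exact ((h21 ⟨t, h⟩ w).1 ((he₂ ⟨t, h⟩).symm.trans hw.symm)).1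

end Gluing

/-! ### Complex structure and foliation of the glued surface -/

section Surface

variable {S : Type} [TopologicalSpace S]

open Classical in
/-- The atlas consisting of the inverses of two local parametrizations that cover a space. -/
abbrev twoChartSpace (e₁ e₂ : OpenPartialHomeomorph (ℂ × ℂ) S)
    (h : e₁.target ∪ e₂.target = Set.univ) : ChartedSpace (ℂ × ℂ) S where
  atlas := {e₁.symm, e₂.symm}
  chartAt p := if p ∈ e₁.target then e₁.symm else e₂.symm
  mem_chart_source p := by
    by_cases hp : p ∈ e₁.target
    · rw [if_pos hp]; exact hp
    · rw [if_neg hp]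
      exact (h.symm ▸ Set.mem_univ p : p ∈ e₁.target ∪ e₂.target).resolve_left hp
  chart_mem_atlas p := by split_ifs <;> simp

/-- The change of charts need only be complex differentiable, by Goursat's theorem in two
variables. -/
theorem isManifold_twoChartSpace (e₁ e₂ : OpenPartialHomeomorph (ℂ × ℂ) S)
    (h : e₁.target ∪ e₂.target = Set.univ)
    (h₁₂ : DifferentiableOn ℂ (e₂.symm ∘ e₁) (e₁.trans e₂.symm).source)
    (h₂₁ : DifferentiableOn ℂ (e₁.symm ∘ e₂) (e₂.trans e₁.symm).source) :
    let _ := twoChartSpace e₁ e₂ h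
    IsManifold 𝓘(ℂ, ℂ × ℂ) ω S := by
  let _ := twoChartSpace e₁ e₂ h
  have hself : ∀ e : OpenPartialHomeomorph (ℂ × ℂ) S,
      DifferentiableOn ℂ (e.symm ∘ e) (e.trans e.symm).source := fun e =>
    differentiableOn_id.congr fun x hx => e.left_inv hx.1
  refine isManifold_of_contDiffOn _ _ _ fun e e' he he' => ?_
  suffices H : DifferentiableOn ℂ (e' ∘ e.symm) (e.symm.trans e').source by
    simpa using (H.analyticOnNhd_prod (e.symm.trans e').open_source).contDiffOn
      (e.symm.trans e').open_source.uniqueDiffOn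
  rcases he with rfl | rfl <;> rcases he' with rfl | rfl
  · exact hself e₁
  · exact h₁₂
  · exact h₂₁
  · exact hself e₂

variable [ChartedSpace (ℂ × ℂ) S]

theorem IsFirstIntegralOn.isFoliationOn {D : TangentField S} {H : S → ℂ} {N : Set S}
    (h : IsFirstIntegralOn D H N) (hN : IsOpen N) : IsFoliationOn D N := by
  refine ⟨hN, fun p hp => ⟨N, hN, hp, subset_rfl, fun _ => 1, fun _ => 0, H, H,
    mdifferentiableOn_const, mdifferentiableOn_const, h.1, h.1, fun q hq => ?_, fun q hq _ => ?_⟩⟩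
  · rw [(h.2 q hq).2]
    simp
  · rw [(h.2 q hq).2]
    intro htop
    refine (h.2 q hq).1 (ContinuousLinearMap.ext fun x => ?_)
    exact LinearMap.mem_ker.1 (htop.symm ▸ Submodule.mem_top : x ∈ (differential H q).ker)

theorem IsFoliationOn.union {D : TangentField S} {V V' : Set S} (h : IsFoliationOn D V)
    (h' : IsFoliationOn D V') : IsFoliationOn D (V ∪ V') := by
  refine ⟨h.1.union h'.1, ?_⟩
  rintro p (hp | hp)
  · obtain ⟨N, hN, hpN, hNV, H⟩ := h.2 p hp
    exact ⟨N, hN, hpN, hNV.trans Set.subset_union_left, H⟩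
  · obtain ⟨N, hN, hpN, hNV, H⟩ := h'.2 p hp
    exact ⟨N, hN, hpN, hNV.trans Set.subset_union_right, H⟩

/-- The tangent field on the target of the parametrization `e` that corresponds to `D`. It is written
as a preimage under the differential of `e.symm`, so that no base points have to be identified; see
`pushforwardField_eq_map`. -/
def pushforwardField (e : OpenPartialHomeomorph (ℂ × ℂ) S) (D : TangentField (ℂ × ℂ)) :
    TangentField S := fun p =>
  (D (e.symm p)).comap (mfderiv 𝓘(ℂ, ℂ × ℂ) 𝓘(ℂ, ℂ × ℂ) e.symm p).toLinearMap

variable {e : OpenPartialHomeomorph (ℂ × ℂ) S}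

theorem differential_comp_symm (he : e.MDifferentiable 𝓘(ℂ, ℂ × ℂ) 𝓘(ℂ, ℂ × ℂ)) {u : ℂ × ℂ → ℂ}
    {p : S} (hp : p ∈ e.target) (hu : MDifferentiableAt 𝓘(ℂ, ℂ × ℂ) 𝓘(ℂ, ℂ) u (e.symm p)) :
    differential (fun q => u (e.symm q)) p = (differential u (e.symm p)).comp
      (mfderiv 𝓘(ℂ, ℂ × ℂ) 𝓘(ℂ, ℂ × ℂ) e.symm p) :=
  mfderiv_comp p hu (he.mdifferentiableAt_symm hp)

theorem IsHolomorphicOn.comp_symm (he : e.MDifferentiable 𝓘(ℂ, ℂ × ℂ) 𝓘(ℂ, ℂ × ℂ))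
    {u : ℂ × ℂ → ℂ} {N : Set (ℂ × ℂ)} (hu : IsHolomorphicOn u N) :
    IsHolomorphicOn (fun q => u (e.symm q)) (e.target ∩ e.symm ⁻¹' N) :=
  MDifferentiableOn.comp hu (he.2.mono Set.inter_subset_left) fun _ hq => hq.2

theorem IsFoliationOn.pushforward (he : e.MDifferentiable 𝓘(ℂ, ℂ × ℂ) 𝓘(ℂ, ℂ × ℂ))
    {D : TangentField (ℂ × ℂ)} (hD : IsFoliationOn D e.source) {G : TangentField S}
    (hG : ∀ p ∈ e.target, G p = pushforwardField e D p) : IsFoliationOn G e.target := by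
  refine ⟨e.open_target, fun p hp => ?_⟩
  obtain ⟨N, hN, hpN, hNV, a, b, u, v, ha, hb, hu, hv, hker, hne⟩ := hD.2 _ (e.map_target hp)
  refine ⟨e.target ∩ e.symm ⁻¹' N, e.symm.isOpen_inter_preimage hN, ⟨hp, hpN⟩,
    Set.inter_subset_left, fun q => a (e.symm q), fun q => b (e.symm q), fun q => u (e.symm q),
    fun q => v (e.symm q), ha.comp_symm he, hb.comp_symm he, hu.comp_symm he, hv.comp_symm he,
    fun q hq => ?_, fun q hq hqp htop => ?_⟩
  · rw [hG q hq.1, pushforwardField, hker _ hq.2,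
      differential_comp_symm he hq.1 ((hu _ hq.2).mdifferentiableAt (hN.mem_nhds hq.2)),
      differential_comp_symm he hq.1 ((hv _ hq.2).mdifferentiableAt (hN.mem_nhds hq.2))]
    rfl
  · refine hne _ hq.2 (fun h => hqp ?_) ?_
    · rw [← e.right_inv hq.1, h, e.right_inv hp]
    · rw [hG q hq.1, pushforwardField, ← LinearMap.range_le_iff_comap] at htop
      rw [eq_top_iff, ← (LinearMap.range_eq_top.2 (he.symm.mfderiv_surjective hq.1))]
      exact htop

theorem pushforwardField_eq_map (he : e.MDifferentiable 𝓘(ℂ, ℂ × ℂ) 𝓘(ℂ, ℂ × ℂ))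
    {D : TangentField (ℂ × ℂ)} {p : ℂ × ℂ} (hp : p ∈ e.source) :
    pushforwardField e D (e p) =
      (D p).map (mfderiv 𝓘(ℂ, ℂ × ℂ) 𝓘(ℂ, ℂ × ℂ) e p).toLinearMap := by
  have h1 := he.symm_comp_deriv hp
  have h2 := he.comp_symm_deriv (e.map_source hp)
  rw [e.left_inv hp] at h2
  have h3 : ∀ q, q = p → ∀ y : ℂ × ℂ, y ∈ (D q : Submodule ℂ (ℂ × ℂ)) ↔
      y ∈ (D p : Submodule ℂ (ℂ × ℂ)) := by
    rintro q rfl y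
    rfl
  ext x
  constructor
  · intro hx
    exact ⟨_, (h3 _ (e.left_inv hp) _).1 hx, DFunLike.congr_fun h2 x⟩
  · rintro ⟨y, hy, rfl⟩
    refine (h3 _ (e.left_inv hp) _).2 ?_
    exact (congrArg (· ∈ (D p : Submodule ℂ (ℂ × ℂ))) (DFunLike.congr_fun h1 y)).mpr hy

theorem IsFirstIntegralOn.pushforward (he : e.MDifferentiable 𝓘(ℂ, ℂ × ℂ) 𝓘(ℂ, ℂ × ℂ))
    {H : ℂ × ℂ → ℂ} {G : TangentField S} (hH : IsHolomorphicOn H e.source)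
    (hH0 : ∀ q ∈ e.source, differential H q ≠ 0)
    (hG : ∀ p ∈ e.target, G p = (differential (fun q => H (e.symm q)) p).ker) :
    IsFirstIntegralOn G (fun q => H (e.symm q)) e.target := by
  refine ⟨MDifferentiableOn.comp hH he.2 fun _ hq => e.map_target hq,
    fun p hp => ⟨fun h0 => hH0 _ (e.map_target hp) ?_, hG p hp⟩⟩
  rw [differential_comp_symm he hp ((hH _ (e.map_target hp)).mdifferentiableAt
    (e.open_source.mem_nhds (e.map_target hp)))] at h0
  refine ContinuousLinearMap.ext fun y => ?_
  obtain ⟨x, rfl⟩ := he.symm.mfderiv_surjective hp y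
  exact DFunLike.congr_fun h0 x

end Surface

/-- A foliated open set `W` of `ℂ²` and an open set `T` foliated by the levels of the second
coordinate are glued along a foliated biholomorphism `τ`, by `exists_glued_space`. -/
theorem exists_glued_surface {D : TangentField (ℂ × ℂ)} {W T : Set (ℂ × ℂ)}
    (hD : IsFoliationOn D W) (hT : IsOpen T) (hWc : IsConnected W) (hTc : IsConnected T)
    (τ : OpenPartialHomeomorph (ℂ × ℂ) (ℂ × ℂ)) (hne : τ.source.Nonempty)
    (hs : τ.source ⊆ T) (ht : τ.target ⊆ W)
    (hτ : DifferentiableOn ℂ τ τ.source) (hτs : DifferentiableOn ℂ τ.symm τ.target)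
    (hτD : IsFirstIntegralOn D (fun p => (τ.symm p).2) τ.target)
    (hsep : ∀ t ∈ T, t ∉ τ.source → ∀ w ∈ W, ∃ N M : Set (ℂ × ℂ), IsOpen N ∧ IsOpen M ∧
      t ∈ N ∧ w ∈ M ∧ ∀ t' ∈ N ∩ τ.source, τ t' ∉ M) :
    ∃ (S : Type) (_ : TopologicalSpace S) (_ : ChartedSpace (ℂ × ℂ) S)
      (_ : IsManifold 𝓘(ℂ, ℂ × ℂ) ω S) (G : TangentField S)
      (e₁ e₂ : OpenPartialHomeomorph (ℂ × ℂ) S),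
      T2Space S ∧ SecondCountableTopology S ∧ ConnectedSpace S ∧ IsFoliationOn G Set.univ ∧
      e₁.source = W ∧ e₂.source = T ∧ e₁.MDifferentiable 𝓘(ℂ, ℂ × ℂ) 𝓘(ℂ, ℂ × ℂ) ∧
      (∀ t ∈ τ.source, e₂ t = e₁ (τ t)) ∧
      (∀ p ∈ W, G (e₁ p) =
        (D p).map (mfderiv 𝓘(ℂ, ℂ × ℂ) 𝓘(ℂ, ℂ × ℂ) e₁ p).toLinearMap) ∧
      IsFirstIntegralOn G (fun p => (e₂.symm p).2) e₂.target := by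
  classical
  obtain ⟨S, _, e₁, e₂, hT2, hSC, hs₁, hs₂, hcov, hglue, hback⟩ :=
    exists_glued_space hD.1 hT hWc.nonempty hTc.nonempty τ hs ht hsep
  have hsymm : ∀ t ∈ τ.source, e₁.symm (e₂ t) = τ t := fun t h => by
    rw [hglue t h]
    exact e₁.left_inv (hs₁ ▸ ht (τ.map_source h))
  have hsymm' : ∀ w ∈ τ.target, e₂.symm (e₁ w) = τ.symm w := fun w h => by
    have h1 := τ.map_target h
    rw [← τ.right_inv h, ← hglue _ h1, τ.left_inv h1]
    exact e₂.left_inv (hs₂ ▸ hs h1)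
  have hsrc : ∀ t ∈ (e₂.trans e₁.symm).source, t ∈ τ.source := fun t h =>
    hback t (hs₂ ▸ h.1) h.2
  have hover : ∀ w ∈ e₁.source, e₁ w ∈ e₂.target → w ∈ τ.target := fun w hw h => by
    have h1 : e₂.symm (e₁ w) ∈ τ.source := by
      refine hback _ (hs₂ ▸ e₂.map_target h) ?_
      rw [e₂.right_inv h]
      exact e₁.map_source hw
    have h2 : e₁ w = e₁ (τ (e₂.symm (e₁ w))) := by rw [← hglue _ h1, e₂.right_inv h]
    rw [e₁.injOn hw (hs₁ ▸ ht (τ.map_source h1)) h2]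
    exact τ.map_source h1
  let _ := twoChartSpace e₁ e₂ hcov
  have hS : IsManifold 𝓘(ℂ, ℂ × ℂ) ω S := isManifold_twoChartSpace e₁ e₂ hcov
    (hτs.congr_mono (fun w hw => hsymm' w (hover w hw.1 hw.2)) fun w hw => hover w hw.1 hw.2)
    (hτ.congr_mono (fun t ht => hsymm t (hsrc t ht)) hsrc)
  have : IsManifold 𝓘(ℂ, ℂ × ℂ) 1 S := IsManifold.of_le (n := ω) le_top
  have he₁ : e₁.MDifferentiable 𝓘(ℂ, ℂ × ℂ) 𝓘(ℂ, ℂ × ℂ) :=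
    (mdifferentiable_of_mem_atlas (e := e₁.symm) (Or.inl rfl)).symm
  have he₂ : e₂.MDifferentiable 𝓘(ℂ, ℂ × ℂ) 𝓘(ℂ, ℂ × ℂ) :=
    (mdifferentiable_of_mem_atlas (e := e₂.symm) (Or.inr rfl)).symm
  let G : TangentField S := fun p => if p ∈ e₂.target then
    (differential (fun q => (e₂.symm q).2) p).ker else pushforwardField e₁ D p
  have hG₂ : ∀ p ∈ e₂.target, G p = (differential (fun q => (e₂.symm q).2) p).ker :=
    fun p hp => if_pos hp
  -- where both descriptions of `G` apply they agree, because `τ` respects the foliations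
  have hG₁ : ∀ p ∈ e₁.target, G p = pushforwardField e₁ D p := by
    intro p hp
    by_cases hp2 : p ∈ e₂.target
    · have hw : e₁.symm p ∈ τ.target := hover _ (e₁.map_target hp) (by rwa [e₁.right_inv hp])
      rw [hG₂ p hp2, pushforwardField, (hτD.2 _ hw).2]
      have h1 : (fun q => (e₂.symm q).2) =ᶠ[𝓝 p] fun q => (τ.symm (e₁.symm q)).2 := by
        filter_upwards [e₁.open_target.mem_nhds hp, e₂.open_target.mem_nhds hp2] with q hq hq2
        rw [← hsymm' _ (hover _ (e₁.map_target hq) (by rwa [e₁.right_inv hq])), e₁.right_inv hq]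
      have h2 : differential (fun q => (e₂.symm q).2) p =
          differential (fun q => (τ.symm (e₁.symm q)).2) p := h1.mfderiv_eq
      rw [h2, differential_comp_symm (u := fun w => (τ.symm w).2) he₁ hp
        ((hτD.1 _ hw).mdifferentiableAt (τ.open_target.mem_nhds hw))]
      rfl
    · exact if_neg hp2
  have hint : IsFirstIntegralOn G (fun p => (e₂.symm p).2) e₂.target := by
    refine IsFirstIntegralOn.pushforward (H := Prod.snd) he₂
      (mdifferentiableOn_iff_differentiableOn.2 differentiableOn_snd) (fun q _ h => ?_) hG₂
    have h1 : differential (Prod.snd : ℂ × ℂ → ℂ) q = ContinuousLinearMap.snd ℂ ℂ ℂ :=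
      mfderiv_eq_fderiv.trans fderiv_snd
    rw [h1] at h
    exact one_ne_zero (DFunLike.congr_fun h ((0, 1) : ℂ × ℂ) : (1 : ℂ) = 0)
  refine ⟨S, _, _, hS, G, e₁, e₂, hT2, hSC, ?_, ?_, hs₁, hs₂, he₁, hglue, ?_, hint⟩
  · obtain ⟨t, htn⟩ := hne
    have c1 : IsConnected e₁.target := by
      rw [← e₁.image_source_eq_target, hs₁]
      exact hWc.image _ (hs₁ ▸ e₁.continuousOn)
    have c2 : IsConnected e₂.target := by
      rw [← e₂.image_source_eq_target, hs₂]
      exact hTc.image _ (hs₂ ▸ e₂.continuousOn)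
    refine connectedSpace_iff_univ.2 (hcov ▸ c1.union ⟨e₂ t, ?_, e₂.map_source (hs₂ ▸ hs htn)⟩ c2)
    rw [hglue t htn]
    exact e₁.map_source (hs₁ ▸ ht (τ.map_source htn))
  · rw [← hcov]
    exact (IsFoliationOn.pushforward he₁ (hs₁ ▸ hD) hG₁).union (hint.isFoliationOn e₂.open_target)
  · intro p hp
    have hp' : p ∈ e₁.source := hs₁ ▸ hp
    rw [hG₁ _ (e₁.map_source hp'), pushforwardField_eq_map he₁ hp']

/-! ### The gluing domain -/

/-- An open neighbourhood of the adapted regions `U_{A,B}` with `A < a` and `B ≤ b`. -/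
def saddleDomain (lam a b η : ℝ) : Set (ℂ × ℂ) :=
  {p | ‖p.1‖ < 1 + η ∧ ‖p.2‖ < b * (1 + η) ∧ ‖p.2‖ * ‖p.1‖ ^ lam < a}

section SaddleDomain

variable {lam a b η : ℝ}

theorem isOpen_saddleDomain (hlam : 0 < lam) : IsOpen (saddleDomain lam a b η) := by
  have h : Continuous fun p : ℂ × ℂ => ‖p.2‖ * ‖p.1‖ ^ lam :=
    continuous_snd.norm.mul (continuous_fst.norm.rpow_const fun _ => Or.inr hlam.le)
  exact (isOpen_lt continuous_fst.norm continuous_const).inter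
    ((isOpen_lt continuous_snd.norm continuous_const).inter (isOpen_lt h continuous_const))

theorem zero_mem_saddleDomain (ha : 0 < a) (hb : 0 < b) (hη : 0 < η) :
    (0 : ℂ × ℂ) ∈ saddleDomain lam a b η := by
  refine ⟨?_, ?_, ?_⟩
  · simp; positivity
  · simp; positivity
  · simpa using ha

theorem isConnected_saddleDomain (hlam : 0 < lam) (ha : 0 < a) (hb : 0 < b) (hη : 0 < η) :
    IsConnected (saddleDomain lam a b η) := by
  refine (StarConvex.isPathConnected (a := (0 : ℂ × ℂ)) ?_
    (zero_mem_saddleDomain ha hb hη)).isConnected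
  rw [starConvex_zero_iff]
  rintro p ⟨h1, h2, h3⟩ t ht0 ht1
  have e1 : ‖(t • p).1‖ ≤ ‖p.1‖ := by
    rw [Prod.smul_fst, norm_smul, Real.norm_of_nonneg ht0]
    exact mul_le_of_le_one_left (norm_nonneg _) ht1
  have e2 : ‖(t • p).2‖ ≤ ‖p.2‖ := by
    rw [Prod.smul_snd, norm_smul, Real.norm_of_nonneg ht0]
    exact mul_le_of_le_one_left (norm_nonneg _) ht1
  refine ⟨e1.trans_lt h1, e2.trans_lt h2, lt_of_le_of_lt ?_ h3⟩
  gcongr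

theorem _root_.Convex.isSimplyConnected {s : Set (ℂ × ℂ)} (hs : Convex ℝ s) (hne : s.Nonempty) :
    IsSimplyConnected s :=
  have := hs.contractibleSpace hne
  SimplyConnectedSpace.ofContractible s

theorem isSimplyConnected_saddleDomain_vertical (hlam : 0 < lam) (ha : 0 < a) (hb : 0 < b)
    (hη : 0 < η) : IsSimplyConnected (saddleDomain lam a b η ∩ {p | p.1 = 0}) := by
  have : saddleDomain lam a b η ∩ {p | p.1 = 0} =
      ({0} : Set ℂ) ×ˢ Metric.ball (0 : ℂ) (b * (1 + η)) := by
    ext p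
    simp only [saddleDomain, Set.mem_inter_iff, Set.mem_ofPred_eq, Set.mem_prod,
      Set.mem_singleton_iff, mem_ball_zero_iff]
    constructor
    · exact fun h => ⟨h.2, h.1.2.1⟩
    · rintro ⟨h, h'⟩
      refine ⟨⟨?_, h', ?_⟩, h⟩
      · rw [h, norm_zero]; positivity
      · rw [h, norm_zero, Real.zero_rpow hlam.ne', mul_zero]; exact ha
  rw [this]
  exact ((convex_singleton 0).prod (convex_ball _ _)).isSimplyConnected
    ⟨(0, 0), rfl, Metric.mem_ball_self (by positivity)⟩

theorem isSimplyConnected_saddleDomain_horizontal (ha : 0 < a) (hb : 0 < b)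
    (hη : 0 < η) : IsSimplyConnected (saddleDomain lam a b η ∩ {p | p.2 = 0}) := by
  have : saddleDomain lam a b η ∩ {p | p.2 = 0} =
      Metric.ball (0 : ℂ) (1 + η) ×ˢ ({0} : Set ℂ) := by
    ext p
    simp only [saddleDomain, Set.mem_inter_iff, Set.mem_ofPred_eq, Set.mem_prod,
      Set.mem_singleton_iff, mem_ball_zero_iff]
    constructor
    · exact fun h => ⟨h.1.1, h.2⟩
    · rintro ⟨h, h'⟩
      refine ⟨⟨h, ?_, ?_⟩, h'⟩
      · rw [h', norm_zero]; positivity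
      · rw [h', norm_zero, zero_mul]; exact ha
  rw [this]
  exact ((convex_ball _ _).prod (convex_singleton 0)).isSimplyConnected
    ⟨(0, 0), Metric.mem_ball_self (by positivity), rfl⟩

theorem isCompact_adaptedRegion (hlam : 0 < lam) : IsCompact (adaptedRegion lam a b) := by
  have h : Continuous fun p : ℂ × ℂ => ‖p.2‖ * ‖p.1‖ ^ lam :=
    continuous_snd.norm.mul (continuous_fst.norm.rpow_const fun _ => Or.inr hlam.le)
  refine ((isCompact_closedBall (0 : ℂ) 1).prod (isCompact_closedBall (0 : ℂ) b)).of_isClosed_subset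
    ((isClosed_le h continuous_const).inter ((isClosed_le continuous_fst.norm continuous_const).inter
      (isClosed_le continuous_snd.norm continuous_const))) fun p hp => ?_
  exact ⟨mem_closedBall_zero_iff.2 hp.2.1, mem_closedBall_zero_iff.2 hp.2.2⟩

theorem adaptedRegion_subset_saddleDomain {A : ℝ} (hA : A < a) (hb : 0 < b) (hη : 0 < η) :
    adaptedRegion lam A b ⊆ saddleDomain lam a b η := fun p hp =>
  ⟨by linarith [hp.2.1], by nlinarith [hp.2.2], hp.1.trans_lt hA⟩

/-- The domain `saddleDomain lam a b η` lies in any neighbourhood of `U_{a,b}` if `η` is small: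
contracting `saddleDomain lam a b η` by the factor `1 + η` brings it into
`U_{a,b}`, which is compact. -/
theorem exists_saddleDomain_subset (hlam : 0 < lam) (hb : 0 < b) {U : Set (ℂ × ℂ)}
    (hU : IsOpen U) (hsub : adaptedRegion lam a b ⊆ U) {c : ℝ} (hc : 0 < c) :
    ∃ η, 0 < η ∧ η ≤ c ∧ saddleDomain lam a b η ⊆ U := by
  obtain ⟨δ, hδ, hδU⟩ := (isCompact_adaptedRegion hlam).exists_thickening_subset_open hU hsub
  refine ⟨min c (δ / (2 * (1 + b))), by positivity, min_le_left _ _, fun p hp => hδU ?_⟩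
  set η := min c (δ / (2 * (1 + b))) with hηdef
  have hη : 0 < η := by positivity
  have hη' : η * (1 + b) ≤ δ / 2 := by
    calc η * (1 + b) ≤ δ / (2 * (1 + b)) * (1 + b) := by gcongr; exact min_le_right _ _
      _ = δ / 2 := by field_simp
  obtain ⟨h1, h2, h3⟩ := hp
  have hk : (0 : ℝ) < 1 + η := by positivity
  have n1 : ‖((1 + η)⁻¹ • p).1‖ = ‖p.1‖ / (1 + η) := by
    rw [Prod.smul_fst, norm_smul, Real.norm_of_nonneg (by positivity)]; ring
  have n2 : ‖((1 + η)⁻¹ • p).2‖ = ‖p.2‖ / (1 + η) := by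
    rw [Prod.smul_snd, norm_smul, Real.norm_of_nonneg (by positivity)]; ring
  have d1 : ‖p.1‖ / (1 + η) ≤ ‖p.1‖ := div_le_self (norm_nonneg _) (by linarith)
  have d2 : ‖p.2‖ / (1 + η) ≤ ‖p.2‖ := div_le_self (norm_nonneg _) (by linarith)
  rw [Metric.mem_thickening_iff]
  refine ⟨(1 + η)⁻¹ • p, ⟨?_, ?_, ?_⟩, ?_⟩
  · rw [n1, n2]
    refine le_trans ?_ h3.le
    gcongr
  · rw [n1, div_le_one hk]; exact h1.le
  · rw [n2, div_le_iff₀ hk]; exact h2.le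
  · have e : p - (1 + η)⁻¹ • p = (η / (1 + η)) • p := by
      have : (1 : ℝ) - (1 + η)⁻¹ = η / (1 + η) := by field_simp; ring
      rw [← this, sub_smul, one_smul]
    rw [dist_eq_norm, e, norm_smul, Real.norm_of_nonneg (by positivity)]
    have hp' : ‖p‖ ≤ (1 + b) * (1 + η) := by
      rw [Prod.norm_def, max_le_iff]
      constructor <;> nlinarith
    calc η / (1 + η) * ‖p‖ ≤ η / (1 + η) * ((1 + b) * (1 + η)) := by gcongr
      _ = η * (1 + b) := by field_simp
      _ < δ := by linarith

end SaddleDomain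

/-! ### Prepared foliations and their flow boxes -/

/-- The coefficient of `dx` in the form that defines a prepared saddle foliation. -/
def preparedCoeff (lam : ℝ) (n : ℕ) (K : ℂ × ℂ → ℂ) (p : ℂ × ℂ) : ℂ :=
  (lam : ℂ) * p.2 * (1 + p.1 ^ n * p.2 * K p)

/-- The form `x dy + lam y (1 + x ^ n y K) dx`, whose kernel is `preparedKernel`. -/
def preparedForm (lam : ℝ) (n : ℕ) (K : ℂ × ℂ → ℂ) (p : ℂ × ℂ) : ℂ × ℂ →L[ℂ] ℂ :=
  p.1 • ContinuousLinearMap.snd ℂ ℂ ℂ + preparedCoeff lam n K p • ContinuousLinearMap.fst ℂ ℂ ℂ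

section Prepared

variable {lam : ℝ} {n : ℕ} {K : ℂ × ℂ → ℂ}

theorem preparedForm_apply (p x : ℂ × ℂ) :
    preparedForm lam n K p x = p.1 * x.2 + preparedCoeff lam n K p * x.1 := by
  simp [preparedForm]

theorem preparedCoeff_of_fst_eq_zero (hn : 1 ≤ n) {p : ℂ × ℂ} (hp : p.1 = 0) :
    preparedCoeff lam n K p = lam * p.2 := by
  simp [preparedCoeff, hp, Nat.one_le_iff_ne_zero.1 hn]

theorem preparedForm_ne_zero (hlam : 0 < lam) (hn : 1 ≤ n) {p : ℂ × ℂ} (hp : p ≠ 0) :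
    preparedForm lam n K p ≠ 0 := fun h => by
  have h1 : p.1 = 0 := by
    simpa [preparedForm_apply] using DFunLike.congr_fun h ((0, 1) : ℂ × ℂ)
  have h2 : preparedCoeff lam n K p = 0 := by
    simpa [preparedForm_apply] using DFunLike.congr_fun h ((1, 0) : ℂ × ℂ)
  rw [preparedCoeff_of_fst_eq_zero hn h1] at h2
  exact hp (Prod.ext h1 ((mul_eq_zero.1 h2).resolve_left (by exact_mod_cast hlam.ne')))

theorem _root_.DifferentiableOn.preparedCoeff {U : Set (ℂ × ℂ)} (hK : DifferentiableOn ℂ K U) :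
    DifferentiableOn ℂ (preparedCoeff lam n K) U := by
  unfold SaddleLoop.preparedCoeff
  fun_prop

theorem isFoliationOn_prepared (hlam : 0 < lam) (hn : 1 ≤ n) {W : Set (ℂ × ℂ)} (hW : IsOpen W)
    (hK : DifferentiableOn ℂ K W) {D : TangentField (ℂ × ℂ)}
    (hD : ∀ p ∈ W, D p = preparedKernel lam n K p) : IsFoliationOn D W := by
  have hD' : ∀ p ∈ W, D p = (preparedForm lam n K p).ker := hD
  refine ⟨hW, fun p hp => ⟨W ∩ ({p} ∪ {0}ᶜ), ?_, ⟨hp, Or.inl rfl⟩, Set.inter_subset_left,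
    Prod.fst, preparedCoeff lam n K, Prod.snd, Prod.fst,
    mdifferentiableOn_iff_differentiableOn.2 differentiableOn_fst,
    mdifferentiableOn_iff_differentiableOn.2 (hK.preparedCoeff.mono Set.inter_subset_left),
    mdifferentiableOn_iff_differentiableOn.2 differentiableOn_snd,
    mdifferentiableOn_iff_differentiableOn.2 differentiableOn_fst, fun q hq => ?_,
    fun q hq hqp htop => ?_⟩⟩
  -- the origin is the only zero of the form
  · by_cases h : p = 0
    · subst h
      simpa using hW
    · have : ({p} ∪ {0}ᶜ : Set (ℂ × ℂ)) = {0}ᶜ := by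
        rw [Set.union_eq_right]
        simpa using Ne.symm h
      rw [this]
      exact hW.inter isOpen_compl_singleton
  · rw [hD' q hq.1]
    have h1 : differential (Prod.snd : ℂ × ℂ → ℂ) q = ContinuousLinearMap.snd ℂ ℂ ℂ :=
      mfderiv_eq_fderiv.trans fderiv_snd
    have h2 : differential (Prod.fst : ℂ × ℂ → ℂ) q = ContinuousLinearMap.fst ℂ ℂ ℂ :=
      mfderiv_eq_fderiv.trans fderiv_fst
    rw [h1, h2]
    rfl
  · rw [hD' q hq.1] at htop
    refine preparedForm_ne_zero (K := K) hlam hn (hq.2.resolve_left hqp) (ContinuousLinearMap.ext fun x => ?_)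
    exact DFunLike.congr_fun (LinearMap.ker_eq_top.1 htop) x

theorem eq_add_mul_of_hasDerivAt {ρ : ℝ} {f : ℂ → ℂ} {c : ℂ}
    (h : ∀ s ∈ Metric.ball (0 : ℂ) ρ, HasDerivAt f c s) {s : ℂ} (hs : s ∈ Metric.ball (0 : ℂ) ρ) :
    f s = f 0 + c * s := by
  have h0 : (0 : ℂ) ∈ Metric.ball (0 : ℂ) ρ :=
    Metric.mem_ball_self (dist_nonneg.trans_lt hs)
  have := (convex_ball (0 : ℂ) ρ).norm_image_sub_le_of_norm_hasDerivWithin_le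
    (f := fun s => f s - c * s) (f' := fun _ => 0) (C := 0) (fun x hx => by
      have h1 : HasDerivAt (fun s => f s - c * s) (c - c * 1) x :=
        (h x hx).sub ((hasDerivAt_id x).const_mul c)
      simpa using h1.hasDerivWithinAt)
    (by simp) h0 hs
  have h2 : f s - c * s - (f 0 - c * 0) = 0 := by simpa using this
  linear_combination h2

theorem mem_ball_prod_zero {ρ : ℝ} {w : ℂ × ℂ} :
    w ∈ Metric.ball (0 : ℂ × ℂ) ρ ↔ ‖w.1‖ < ρ ∧ ‖w.2‖ < ρ := by
  rw [mem_ball_zero_iff, Prod.norm_def, max_lt_iff]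

/-- A flow box of a prepared saddle foliation at `(1, 0)`, for the transversal `{x = 1}`; the time
is `x - 1`. -/
theorem exists_flowBox_horizontal {U : Set (ℂ × ℂ)} (hU : IsOpen U)
    (hK : DifferentiableOn ℂ K U) {D : TangentField (ℂ × ℂ)}
    (hD : ∀ p ∈ U, D p = preparedKernel lam n K p) (h1U : ((1, 0) : ℂ × ℂ) ∈ U) :
    ∃ (φ : OpenPartialHomeomorph (ℂ × ℂ) (ℂ × ℂ)) (ρ : ℝ), 0 < ρ ∧
      φ.source = Metric.ball 0 ρ ∧ φ.target ⊆ {p | p ∈ U ∧ ‖p.1 - 1‖ < 1 / 2} ∧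
      DifferentiableOn ℂ φ φ.source ∧ DifferentiableOn ℂ φ.symm φ.target ∧
      (∀ z ∈ Metric.ball (0 : ℂ) ρ, φ (0, z) = (1, z)) ∧
      (∀ w ∈ Metric.ball (0 : ℂ × ℂ) ρ, (φ w).1 = 1 + w.1) ∧
      IsFirstIntegralOn D (fun p => (φ.symm p).2) φ.target := by
  have hA := hK.preparedCoeff (lam := lam) (n := n) |>.analyticOnNhd_prod hU
  obtain ⟨φ, ρ, hρ, hs, ht, hd, hds, h0, hv⟩ := exists_flowBox
    (v := fun p => (1, -preparedCoeff lam n K p / p.1)) (R := fun z => ((1 : ℂ), z))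
    (analyticAt_const.prod ((hA _ h1U).neg.div analyticAt_fst one_ne_zero))
    (analyticAt_const.prod analyticAt_id)
    (by
      have : HasDerivAt (fun z : ℂ => ((1 : ℂ), z)) (0, 1) 0 :=
        (hasDerivAt_const _ _).prodMk (hasDerivAt_id _)
      rw [this.deriv]
      simp)
    (O := {p | p ∈ U ∧ ‖p.1 - 1‖ < 1 / 2})
    ((hU.inter (isOpen_lt (f := fun p : ℂ × ℂ => ‖p.1 - 1‖) (by fun_prop)
      continuous_const)).mem_nhds ⟨h1U, by simp⟩)
  have hne : ∀ p ∈ φ.target, p.1 ≠ 0 := fun p hp h => by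
    have := (ht hp).2
    rw [h] at this
    norm_num at this
  refine ⟨φ, ρ, hρ, hs, ht, hd, hds, h0, fun w hw => ?_, ?_⟩
  · rw [mem_ball_prod_zero] at hw
    have := eq_add_mul_of_hasDerivAt (ρ := ρ) (f := fun s => (φ (s, w.2)).1) (c := 1)
      (fun s hs => (hv (s, w.2) (mem_ball_prod_zero.2 ⟨mem_ball_zero_iff.1 hs, hw.2⟩)).fst)
      (mem_ball_zero_iff.2 hw.1)
    simpa [h0 _ (mem_ball_zero_iff.2 hw.2)] using this
  · refine isFirstIntegralOn_flowBox (v := fun p => (1, -preparedCoeff lam n K p / p.1))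
      (α := preparedForm lam n K) hd hds (hs ▸ hv) (fun p hp => hD p (ht hp).1)
      (fun p hp h => hne p hp ?_) fun p hp => ?_
    · simpa [preparedForm_apply] using DFunLike.congr_fun h ((0, 1) : ℂ × ℂ)
    · rw [preparedForm_apply]
      field_simp [hne p hp]
      ring

/-- A flow box of a prepared saddle foliation at a point `(0, σ)` of the vertical separatrix, for a
transversal parametrized by `R`; the time is `(y - y(R z)) / σ`. -/
theorem exists_flowBox_vertical (hlam : 0 < lam) (hn : 1 ≤ n) {U : Set (ℂ × ℂ)} (hU : IsOpen U)
    (hK : DifferentiableOn ℂ K U) {D : TangentField (ℂ × ℂ)}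
    (hD : ∀ p ∈ U, D p = preparedKernel lam n K p) {R : ℂ → ℂ × ℂ} (hR : AnalyticAt ℂ R 0)
    (hR1 : (R 0).1 = 0) (hR2 : (R 0).2 ≠ 0) (hR' : deriv (fun y => (R y).1) 0 ≠ 0)
    (hRU : R 0 ∈ U) :
    ∃ (φ : OpenPartialHomeomorph (ℂ × ℂ) (ℂ × ℂ)) (ρ : ℝ), 0 < ρ ∧
      φ.source = Metric.ball 0 ρ ∧ φ.target ⊆ {p | p ∈ U ∧ ‖p.1‖ < 1 / 2} ∧
      DifferentiableOn ℂ φ φ.source ∧ DifferentiableOn ℂ φ.symm φ.target ∧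
      (∀ z ∈ Metric.ball (0 : ℂ) ρ, φ (0, z) = R z) ∧
      (∀ w ∈ Metric.ball (0 : ℂ × ℂ) ρ, (φ w).2 = (R w.2).2 + (R 0).2 * w.1) ∧
      IsFirstIntegralOn D (fun p => (φ.symm p).2) φ.target := by
  have hA := hK.preparedCoeff (lam := lam) (n := n) |>.analyticOnNhd_prod hU
  have hc : preparedCoeff lam n K (R 0) ≠ 0 := by
    rw [preparedCoeff_of_fst_eq_zero hn hR1]
    exact mul_ne_zero (by exact_mod_cast hlam.ne') hR2
  obtain ⟨φ, ρ, hρ, hs, ht, hd, hds, h0, hv⟩ := exists_flowBox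
    (v := fun p => (-(R 0).2 * p.1 / preparedCoeff lam n K p, (R 0).2)) (R := R)
    (((analyticAt_const.mul analyticAt_fst).div (hA _ hRU) hc).prod analyticAt_const) hR
    (by
      have : HasDerivAt (fun y => (R y).1) (deriv R 0).1 0 :=
        hR.differentiableAt.hasDerivAt.fst
      rw [this.deriv] at hR'
      simpa [hR1] using ⟨hR2, hR'⟩)
    (O := {p | p ∈ U ∧ ‖p.1‖ < 1 / 2} ∩ {p | preparedCoeff lam n K p ≠ 0})
    (Filter.inter_mem ((hU.inter (isOpen_lt (f := fun p : ℂ × ℂ => ‖p.1‖) (by fun_prop)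
      continuous_const)).mem_nhds ⟨hRU, by simp [hR1]⟩) ((hA _ hRU).continuousAt.eventually_ne hc))
  refine ⟨φ, ρ, hρ, hs, fun p hp => (ht hp).1, hd, hds, h0, fun w hw => ?_, ?_⟩
  · rw [mem_ball_prod_zero] at hw
    have := eq_add_mul_of_hasDerivAt (ρ := ρ) (f := fun s => (φ (s, w.2)).2) (c := (R 0).2)
      (fun s hs => (hv (s, w.2) (mem_ball_prod_zero.2 ⟨mem_ball_zero_iff.1 hs, hw.2⟩)).snd)
      (mem_ball_zero_iff.2 hw.1)
    simpa [h0 _ (mem_ball_zero_iff.2 hw.2)] using this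
  · refine isFirstIntegralOn_flowBox
      (v := fun p => (-(R 0).2 * p.1 / preparedCoeff lam n K p, (R 0).2))
      (α := preparedForm lam n K) hd hds (hs ▸ hv) (fun p hp => hD p (ht hp).1.1)
      (fun p hp h => (ht hp).2 ?_) fun p hp => ?_
    · simpa [preparedForm_apply] using DFunLike.congr_fun h ((1, 0) : ℂ × ℂ)
    · have := (ht hp).2
      rw [Set.mem_ofPred_eq] at this
      rw [preparedForm_apply]
      field_simp
      ring

/-- A transversal through a regular point is carried to itself by the holonomy of a constant
path. -/
theorem holonomyTransports_refl {D : TangentField (ℂ × ℂ)} {V N : Set (ℂ × ℂ)} {H : ℂ × ℂ → ℂ}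
    (hN : IsOpen N) (hNV : N ⊆ V) (hH : IsFirstIntegralOn D H N) {R : ℂ → ℂ × ℂ}
    (hR : AnalyticAt ℂ R 0) (hRN : R 0 ∈ N) :
    HolonomyTransports D V (Path.refl (R 0)) R R := by
  obtain ⟨ρ, hρ, hb⟩ := Metric.eventually_nhds_iff_ball.1
    (hR.eventually_analyticAt.and (hR.continuousAt.eventually (hN.mem_nhds hRN)))
  refine ⟨ρ, hρ, fun _ z => R z, ?_, fun t => rfl, fun z hz => ⟨rfl, rfl, continuous_const,
    fun t => ⟨N, H, hN, (hb z hz).2, hNV, hH, Filter.Eventually.of_forall fun _ => rfl⟩⟩⟩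
  have : ContinuousOn R (Metric.ball 0 ρ) := fun z hz =>
    (hb z hz).1.continuousAt.continuousWithinAt
  exact this.comp continuousOn_snd fun q hq => hq.2

end Prepared

/-! ### Attaching the tube -/

theorem exists_disjointUnion {X Y : Type*} [TopologicalSpace X] [TopologicalSpace Y]
    (e e' : OpenPartialHomeomorph X Y) (hs : Disjoint e.source e'.source)
    (ht : Disjoint e.target e'.target) : ∃ τ : OpenPartialHomeomorph X Y,
      τ.source = e.source ∪ e'.source ∧ τ.target = e.target ∪ e'.target ∧
      Set.EqOn τ e e.source ∧ Set.EqOn τ e' e'.source ∧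
      Set.EqOn τ.symm e.symm e.target ∧ Set.EqOn τ.symm e'.symm e'.target := by
  classical
  exact ⟨e.disjointUnion e' hs ht, rfl, rfl, Set.piecewise_eqOn _ _ _,
    fun x hx => Set.piecewise_eqOn_compl _ _ _ (hs.notMem_of_mem_right hx),
    Set.piecewise_eqOn _ _ _,
    fun x hx => Set.piecewise_eqOn_compl _ _ _ (ht.notMem_of_mem_right hx)⟩

theorem IsFirstIntegralOn.congr {D : TangentField (ℂ × ℂ)} {H H' : ℂ × ℂ → ℂ} {N N' : Set (ℂ × ℂ)}
    (h : IsFirstIntegralOn D H N) (hN' : IsOpen N') (hsub : N' ⊆ N) (he : Set.EqOn H' H N') :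
    IsFirstIntegralOn D H' N' := by
  refine ⟨(h.1.mono hsub).congr fun q hq => he hq, fun q hq => ?_⟩
  have h1 : H' =ᶠ[𝓝 q] H := Filter.eventuallyEq_of_mem (hN'.mem_nhds hq) he
  have h2 : differential H' q = differential H q := h1.mfderiv_eq
  rw [h2]
  exact h.2 q (hsub hq)

theorem IsFirstIntegralOn.union {D : TangentField (ℂ × ℂ)} {H : ℂ × ℂ → ℂ} {N N' : Set (ℂ × ℂ)}
    (h : IsFirstIntegralOn D H N) (h' : IsFirstIntegralOn D H N') (hN : IsOpen N)
    (hN' : IsOpen N') : IsFirstIntegralOn D H (N ∪ N') := by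
  refine ⟨?_, ?_⟩
  · rintro q (hq | hq)
    · exact ((h.1 q hq).mdifferentiableAt (hN.mem_nhds hq)).mdifferentiableWithinAt
    · exact ((h'.1 q hq).mdifferentiableAt (hN'.mem_nhds hq)).mdifferentiableWithinAt
  · rintro q (hq | hq)
    · exact h.2 q hq
    · exact h'.2 q hq

/-- A neighbourhood of the segment `[0, ρ] × {0}`; its leaves are the levels of the second
coordinate. -/
def tube (ρ ρ' : ℝ) : Set (ℂ × ℂ) :=
  {t | -(ρ / 4) < t.1.re ∧ t.1.re < 5 * ρ / 4 ∧ |t.1.im| < ρ / 4 ∧ ‖t.2‖ < ρ'}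

theorem isOpen_tube (ρ ρ' : ℝ) : IsOpen (tube ρ ρ') :=
  (isOpen_lt continuous_const (Complex.continuous_re.comp continuous_fst)).inter
    ((isOpen_lt (Complex.continuous_re.comp continuous_fst) continuous_const).inter
      ((isOpen_lt (Complex.continuous_im.comp continuous_fst).abs continuous_const).inter
        (isOpen_lt continuous_snd.norm continuous_const)))

theorem isConnected_tube {ρ ρ' : ℝ} (hρ : 0 < ρ) (hρ' : 0 < ρ') : IsConnected (tube ρ ρ') := by
  have h0 : (0 : ℂ × ℂ) ∈ tube ρ ρ' := by
    refine ⟨?_, ?_, ?_, ?_⟩ <;> simp <;> positivity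
  refine (StarConvex.isPathConnected (a := (0 : ℂ × ℂ)) ?_ h0).isConnected
  rw [starConvex_zero_iff]
  rintro p ⟨h1, h2, h3, h4⟩ t ht0 ht1
  refine ⟨?_, ?_, ?_, ?_⟩
  · simp only [Prod.smul_fst, Complex.smul_re, smul_eq_mul]; nlinarith
  · simp only [Prod.smul_fst, Complex.smul_re, smul_eq_mul]; nlinarith
  · simp only [Prod.smul_fst, Complex.smul_im, smul_eq_mul, abs_mul, abs_of_nonneg ht0]
    exact (mul_le_of_le_one_left (abs_nonneg _) ht1).trans_lt h3
  · rw [Prod.smul_snd, norm_smul, Real.norm_of_nonneg ht0]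
    exact (mul_le_of_le_one_left (norm_nonneg _) ht1).trans_lt h4

theorem norm_lt_of_tube {ρ : ℝ} {s : ℂ} (h1 : -(ρ / 4) < s.re) (h2 : s.re ≤ ρ / 2)
    (h3 : |s.im| < ρ / 4) : ‖s‖ < ρ := by
  have h4 : |s.re| ≤ ρ / 2 := abs_le.2 ⟨by linarith [abs_nonneg s.im], h2⟩
  linarith [Complex.norm_le_abs_re_add_abs_im s, abs_nonneg s.im]

/-- The reflection that exchanges the two ends of the tube. -/
def tubeReflection (ρ : ℝ) : (ℂ × ℂ) ≃ₜ ℂ × ℂ :=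
  (Homeomorph.subLeft (ρ : ℂ)).prodCongr (Homeomorph.refl ℂ)

theorem tubeReflection_apply (ρ : ℝ) (t : ℂ × ℂ) : tubeReflection ρ t = ((ρ : ℂ) - t.1, t.2) := rfl

theorem tubeReflection_symm_apply (ρ : ℝ) (t : ℂ × ℂ) :
    (tubeReflection ρ).symm t = (-t.1 + (ρ : ℂ), t.2) := rfl

/-- The two ends of the tube are glued to `W` by the flow boxes `φ₁` and `φ₂`. Along the tube both
boxes leave `W` before the middle is reached; this makes the result Hausdorff. -/
theorem exists_tubeGluing {D : TangentField (ℂ × ℂ)} {W : Set (ℂ × ℂ)} (hW : IsOpen W)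
    {φ₁ φ₂ : OpenPartialHomeomorph (ℂ × ℂ) (ℂ × ℂ)} {ρ ρ' : ℝ} (hρ' : ρ' ≤ ρ) {R : ℂ → ℂ × ℂ}
    (hs₁ : Metric.ball 0 ρ ⊆ φ₁.source) (hs₂ : Metric.ball 0 ρ ⊆ φ₂.source)
    (hdisj : Disjoint φ₁.target φ₂.target)
    (hd₁ : DifferentiableOn ℂ φ₁ φ₁.source) (hd₂ : DifferentiableOn ℂ φ₂ φ₂.source)
    (hds₁ : DifferentiableOn ℂ φ₁.symm φ₁.target) (hds₂ : DifferentiableOn ℂ φ₂.symm φ₂.target)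
    (hx : ∀ w ∈ Metric.ball (0 : ℂ × ℂ) ρ, (φ₁ w).1 = 1 + w.1)
    (hy : ∀ w ∈ Metric.ball (0 : ℂ × ℂ) ρ, (φ₂ w).2 = (R w.2).2 + (R 0).2 * w.1)
    (hH₁ : IsFirstIntegralOn D (fun p => (φ₁.symm p).2) φ₁.target)
    (hH₂ : IsFirstIntegralOn D (fun p => (φ₂.symm p).2) φ₂.target)
    (hWx : ∀ p ∈ W, ‖p.1‖ < 1 + ρ / 8) (hWy : ∀ p ∈ W, ‖p.2‖ < ‖(R 0).2‖ * (1 + ρ / 8))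
    (hR : ∀ z, ‖z‖ < ρ' → ‖(R z).2 - (R 0).2‖ ≤ ‖(R 0).2‖ * (ρ / 8)) :
    ∃ τ : OpenPartialHomeomorph (ℂ × ℂ) (ℂ × ℂ), τ.source ⊆ tube ρ ρ' ∧ τ.target ⊆ W ∧
      DifferentiableOn ℂ τ τ.source ∧ DifferentiableOn ℂ τ.symm τ.target ∧
      IsFirstIntegralOn D (fun p => (τ.symm p).2) τ.target ∧
      (∀ t ∈ tube ρ ρ', t.1.re < ρ / 2 → φ₁ t ∈ W → t ∈ τ.source ∧ τ t = φ₁ t) ∧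
      (∀ t ∈ tube ρ ρ', ρ / 2 < t.1.re → φ₂ (tubeReflection ρ t) ∈ W →
        t ∈ τ.source ∧ τ t = φ₂ (tubeReflection ρ t)) ∧
      ∀ t ∈ tube ρ ρ', t ∉ τ.source → ∀ w ∈ W, ∃ N M : Set (ℂ × ℂ), IsOpen N ∧ IsOpen M ∧
        t ∈ N ∧ w ∈ M ∧ ∀ t' ∈ N ∩ τ.source, τ t' ∉ M := by
  have hre : Continuous fun t : ℂ × ℂ => t.1.re := Complex.continuous_re.comp continuous_fst
  have hT₁ : IsOpen (tube ρ ρ' ∩ {t | t.1.re < ρ / 2}) :=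
    (isOpen_tube ρ ρ').inter (isOpen_lt hre continuous_const)
  have hT₂ : IsOpen (tube ρ ρ' ∩ {t | ρ / 2 < t.1.re}) :=
    (isOpen_tube ρ ρ').inter (isOpen_lt continuous_const hre)
  have hb₁ : ∀ t ∈ tube ρ ρ' ∩ {t | t.1.re < ρ / 2}, t ∈ Metric.ball (0 : ℂ × ℂ) ρ := fun t ht =>
    mem_ball_prod_zero.2 ⟨norm_lt_of_tube ht.1.1 (le_of_lt ht.2) ht.1.2.2.1,
      ht.1.2.2.2.trans_le hρ'⟩
  have hb₂ : ∀ t ∈ tube ρ ρ' ∩ {t | ρ / 2 < t.1.re},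
      tubeReflection ρ t ∈ Metric.ball (0 : ℂ × ℂ) ρ := fun t ht => by
    have h2 : ρ / 2 < t.1.re := ht.2
    refine mem_ball_prod_zero.2 ⟨norm_lt_of_tube ?_ ?_ ?_, ht.1.2.2.2.trans_le hρ'⟩
    · simp only [tubeReflection_apply, Complex.sub_re, Complex.ofReal_re]; linarith [ht.1.2.1]
    · simp only [tubeReflection_apply, Complex.sub_re, Complex.ofReal_re]; linarith
    · simpa [tubeReflection_apply] using ht.1.2.2.1
  -- `φ₁` and the reflected `φ₂`, on the parts of the two halves of the tube which they map into `W`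
  let τ₁ := (φ₁.restrOpen _ hT₁).trans (OpenPartialHomeomorph.ofSet W hW)
  let τ₂ := (((tubeReflection ρ).toOpenPartialHomeomorph.trans φ₂).restrOpen _ hT₂).trans
    (OpenPartialHomeomorph.ofSet W hW)
  have hτ₁s : ∀ t, t ∈ τ₁.source ↔ (t ∈ tube ρ ρ' ∧ t.1.re < ρ / 2) ∧ φ₁ t ∈ W := fun t => by
    simp only [τ₁, OpenPartialHomeomorph.trans_source, OpenPartialHomeomorph.restrOpen_source,
      OpenPartialHomeomorph.ofSet_source, Set.mem_inter_iff, Set.mem_preimage]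
    exact ⟨fun h => ⟨h.1.2, h.2⟩, fun h => ⟨⟨hs₁ (hb₁ t h.1), h.1⟩, h.2⟩⟩
  have hτ₂s : ∀ t, t ∈ τ₂.source ↔
      (t ∈ tube ρ ρ' ∧ ρ / 2 < t.1.re) ∧ φ₂ (tubeReflection ρ t) ∈ W := fun t => by
    simp only [τ₂, OpenPartialHomeomorph.trans_source, OpenPartialHomeomorph.restrOpen_source,
      OpenPartialHomeomorph.ofSet_source, Set.mem_inter_iff, Set.mem_preimage]
    exact ⟨fun h => ⟨h.1.2, h.2⟩, fun h => ⟨⟨⟨Set.mem_univ _, hs₂ (hb₂ t h.1)⟩, h.1⟩, h.2⟩⟩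
  have hτ₁ : ∀ t, τ₁ t = φ₁ t := fun t => rfl
  have hτ₂ : ∀ t, τ₂ t = φ₂ (tubeReflection ρ t) := fun t => rfl
  have hτ₁' : ∀ p, τ₁.symm p = φ₁.symm p := fun t => rfl
  have hτ₂' : ∀ p, τ₂.symm p = (tubeReflection ρ).symm (φ₂.symm p) := fun t => rfl
  have ht₁ : τ₁.target ⊆ φ₁.target ∩ W := fun p hp => by
    have h := τ₁.map_target hp
    rw [hτ₁s] at h
    rw [← τ₁.right_inv hp, hτ₁]
    exact ⟨φ₁.map_source (hs₁ (hb₁ _ h.1)), h.2⟩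
  have ht₂ : τ₂.target ⊆ φ₂.target ∩ W := fun p hp => by
    have h := τ₂.map_target hp
    rw [hτ₂s] at h
    rw [← τ₂.right_inv hp, hτ₂]
    exact ⟨φ₂.map_source (hs₂ (hb₂ _ h.1)), h.2⟩
  have hrefl : Differentiable ℂ (tubeReflection ρ) := by
    have : (tubeReflection ρ : ℂ × ℂ → ℂ × ℂ) = fun t => ((ρ : ℂ) - t.1, t.2) := rfl
    rw [this]
    fun_prop
  have hrefl' : Differentiable ℂ (tubeReflection ρ).symm := by
    have : ((tubeReflection ρ).symm : ℂ × ℂ → ℂ × ℂ) = fun t => (-t.1 + (ρ : ℂ), t.2) := rfl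
    rw [this]
    fun_prop
  obtain ⟨τ, hτs, hτt, e1, e2, e1', e2'⟩ := exists_disjointUnion τ₁ τ₂
    (Set.disjoint_left.2 fun t h h' => by
      rw [hτ₁s] at h
      rw [hτ₂s] at h'
      exact lt_asymm h.1.2 h'.1.2)
    (hdisj.mono (fun p hp => (ht₁ hp).1) fun p hp => (ht₂ hp).1)
  -- the middle of the tube is not glued to `W`: there `|x| > 1 + ρ / 8` in the first box, and
  -- `|y| > |σ| (1 + ρ / 8)` in the second one
  have hmid : ∀ t ∈ τ.source, ¬ (ρ / 4 < t.1.re ∧ t.1.re < 3 * ρ / 4) := by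
    rintro t ht ⟨h1, h2⟩
    rw [hτs] at ht
    rcases ht with ht | ht
    · rw [hτ₁s] at ht
      have h3 := hWx _ ht.2
      rw [hx t (hb₁ t ht.1)] at h3
      have h4 := (Complex.re_le_norm (1 + t.1)).trans_lt h3
      simp only [Complex.add_re, Complex.one_re] at h4
      linarith [ht.1.1.1, ht.1.1.2.1]
    · rw [hτ₂s] at ht
      have h3 := hWy _ ht.2
      rw [hy _ (hb₂ t ht.1)] at h3
      simp only [tubeReflection_apply] at h3
      have h4 := hR t.2 ht.1.1.2.2.2
      have h5 : ‖(R 0).2 * (1 + ((ρ : ℂ) - t.1))‖ ≤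
          ‖(R t.2).2 + (R 0).2 * ((ρ : ℂ) - t.1)‖ + ‖(R t.2).2 - (R 0).2‖ := by
        have : (R 0).2 * (1 + ((ρ : ℂ) - t.1)) =
          ((R t.2).2 + (R 0).2 * ((ρ : ℂ) - t.1)) - ((R t.2).2 - (R 0).2) := by ring
        rw [this]
        exact norm_sub_le _ _
      rw [norm_mul] at h5
      have h6 := Complex.re_le_norm (1 + ((ρ : ℂ) - t.1))
      simp only [Complex.add_re, Complex.one_re, Complex.sub_re, Complex.ofReal_re] at h6
      have h7 : ‖(R 0).2‖ * (1 + ρ / 4) ≤ ‖(R 0).2‖ * ‖1 + ((ρ : ℂ) - t.1)‖ := by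
        gcongr
        linarith
      linarith
  refine ⟨τ, ?_, ?_, ?_, ?_, ?_, ?_, ?_, ?_⟩
  · rw [hτs]
    rintro t (h | h)
    · exact ((hτ₁s t).1 h).1.1
    · exact ((hτ₂s t).1 h).1.1
  · rw [hτt]
    rintro p (h | h)
    · exact (ht₁ h).2
    · exact (ht₂ h).2
  · rw [hτs]
    refine DifferentiableOn.union_of_isOpen (DifferentiableOn.congr ?_ e1)
      (DifferentiableOn.congr ?_ e2) τ₁.open_source τ₂.open_source
    · exact hd₁.mono fun t h => hs₁ (hb₁ t ((hτ₁s t).1 h).1)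
    · exact hd₂.comp hrefl.differentiableOn fun t h => hs₂ (hb₂ t ((hτ₂s t).1 h).1)
  · rw [hτt]
    refine DifferentiableOn.union_of_isOpen (DifferentiableOn.congr ?_ e1')
      (DifferentiableOn.congr ?_ e2') τ₁.open_target τ₂.open_target
    · exact hds₁.mono fun p h => (ht₁ h).1
    · exact hrefl'.comp_differentiableOn (hds₂.mono fun p h => (ht₂ h).1)
  · rw [hτt]
    refine IsFirstIntegralOn.union (hH₁.congr τ₁.open_target (fun p h => (ht₁ h).1) ?_)
      (hH₂.congr τ₂.open_target (fun p h => (ht₂ h).1) ?_) τ₁.open_target τ₂.open_target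
    · exact fun p h => by simp only [e1' h, hτ₁']
    · exact fun p h => by simp only [e2' h, hτ₂', tubeReflection_symm_apply]
  · intro t ht h h'
    have hm : t ∈ τ₁.source := (hτ₁s t).2 ⟨⟨ht, h⟩, h'⟩
    exact ⟨hτs ▸ Or.inl hm, e1 hm⟩
  · intro t ht h h'
    have hm : t ∈ τ₂.source := (hτ₂s t).2 ⟨⟨ht, h⟩, h'⟩
    exact ⟨hτs ▸ Or.inr hm, e2 hm⟩
  · intro t ht hts w hw
    rcases lt_trichotomy t.1.re (ρ / 2) with h | h | h
    · have hne : φ₁ t ≠ w := fun he =>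
        hts (hτs ▸ Or.inl ((hτ₁s t).2 ⟨⟨ht, h⟩, by rwa [he]⟩))
      obtain ⟨A, B, hA, hB, htA, hwB, hAB⟩ := t2_separation hne
      refine ⟨tube ρ ρ' ∩ {t | t.1.re < ρ / 2} ∩ φ₁ ⁻¹' A, B,
        (φ₁.continuousOn.mono fun t h => hs₁ (hb₁ t h)).isOpen_inter_preimage hT₁ hA, hB,
        ⟨⟨ht, h⟩, htA⟩, hwB, ?_⟩
      rintro t' ⟨⟨ht', htA'⟩, hts'⟩
      rw [hτs] at hts'
      rcases hts' with hts' | hts'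
      · rw [e1 hts']
        exact Set.disjoint_left.1 hAB htA'
      · exact absurd ((hτ₂s t').1 hts').1.2 (lt_asymm ht'.2)
    · exact ⟨{t | ρ / 4 < t.1.re} ∩ {t | t.1.re < 3 * ρ / 4}, Set.univ,
        (isOpen_lt continuous_const hre).inter (isOpen_lt hre continuous_const), isOpen_univ,
        ⟨by rw [Set.mem_ofPred_eq]; linarith [ht.1, ht.2.1],
          by rw [Set.mem_ofPred_eq]; linarith [ht.1, ht.2.1]⟩, Set.mem_univ _,
        fun t' ht' _ => hmid t' ht'.2 ht'.1⟩
    · have hne : φ₂ (tubeReflection ρ t) ≠ w := fun he =>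
        hts (hτs ▸ Or.inr ((hτ₂s t).2 ⟨⟨ht, h⟩, by rwa [he]⟩))
      obtain ⟨A, B, hA, hB, htA, hwB, hAB⟩ := t2_separation hne
      refine ⟨tube ρ ρ' ∩ {t | ρ / 2 < t.1.re} ∩ (fun t => φ₂ (tubeReflection ρ t)) ⁻¹' A, B,
        (φ₂.continuousOn.comp (tubeReflection ρ).continuous.continuousOn
          fun t h => hs₂ (hb₂ t h)).isOpen_inter_preimage hT₂ hA, hB, ⟨⟨ht, h⟩, htA⟩, hwB, ?_⟩
      rintro t' ⟨⟨ht', htA'⟩, hts'⟩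
      rw [hτs] at hts'
      rcases hts' with hts' | hts'
      · exact absurd ((hτ₁s t').1 hts').1.2 (lt_asymm ht'.2)
      · rw [e2 hts']
        exact Set.disjoint_left.1 hAB htA'

/-! ### Realization of abstract loops -/

/-- The tube carries the holonomy from one of its ends to the other. -/
theorem holonomyTransports_tube {S : Type} [TopologicalSpace S] [ChartedSpace (ℂ × ℂ) S]
    {G : TangentField S} {e : OpenPartialHomeomorph (ℂ × ℂ) S} {ρ ρ' : ℝ} (hρ : 0 < ρ)
    (hρ' : 0 < ρ') (he : e.source = tube ρ ρ')
    (hG : IsFirstIntegralOn G (fun p => (e.symm p).2) e.target) {f g : ℂ → S}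
    (hf : ∀ z, ‖z‖ < ρ' → e (0, z) = f z) (hg : ∀ z, ‖z‖ < ρ' → e ((ρ : ℂ), z) = g z) :
    ∃ γ : Path (f 0) (g 0), HolonomyTransports G Set.univ γ f g := by
  have hmem : ∀ (t : I) (z : ℂ), ‖z‖ < ρ' → (((ρ * t : ℝ) : ℂ), z) ∈ e.source := by
    intro t z hz
    rw [he]
    have h0 : 0 ≤ ρ * (t : ℝ) := mul_nonneg hρ.le t.2.1
    have h1 : ρ * (t : ℝ) ≤ ρ := mul_le_of_le_one_right hρ.le t.2.2
    refine ⟨?_, ?_, ?_, hz⟩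
    · rw [Complex.ofReal_re]; linarith
    · rw [Complex.ofReal_re]; linarith
    · rw [Complex.ofReal_im, abs_zero]; positivity
  have hz0 : ‖(0 : ℂ)‖ < ρ' := by simpa using hρ'
  have hcont : ∀ z, ‖z‖ < ρ' → Continuous fun t : I => e (((ρ * t : ℝ) : ℂ), z) := fun z hz =>
    e.continuousOn.comp_continuous (by fun_prop) fun t => hmem t z hz
  refine ⟨⟨⟨fun t => e (((ρ * t : ℝ) : ℂ), 0), hcont 0 hz0⟩, ?_, ?_⟩, ρ', hρ',
    fun t z => e (((ρ * t : ℝ) : ℂ), z), ?_, fun t => rfl, fun z hz => ?_⟩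
  · simpa using hf 0 hz0
  · simpa using hg 0 hz0
  · exact e.continuousOn.comp (f := fun q : I × ℂ => (((ρ * q.1 : ℝ) : ℂ), q.2)) (by fun_prop)
      fun q hq => hmem q.1 q.2 (mem_ball_zero_iff.1 hq.2)
  · have hz' := mem_ball_zero_iff.1 hz
    refine ⟨by simpa using hf z hz', by simpa using hg z hz', hcont z hz', fun t =>
      ⟨e.target, _, e.open_target, e.map_source (hmem t z hz'), Set.subset_univ _, hG,
        Filter.Eventually.of_forall fun s => ?_⟩⟩
    simp only
    rw [e.left_inv (hmem s z hz'), e.left_inv (hmem t z hz')]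

/-- Every abstract loop is realized on the surface that is obtained from a neighbourhood of an
adapted region by attaching a tube. The tube enters at `(1, 0)` and `(0, σ)`, along the transversals
`{x = 1}` and `Σ`, whose points `(1, z)` and `R z` lie on the same leaf of the tube. -/
theorem exists_realization {lam : ℝ} (hlam : 0 < lam) (l : AbstractLoop lam) :
    ∃ (S : Type) (_ : TopologicalSpace S) (_ : ChartedSpace (ℂ × ℂ) S)
      (_ : IsManifold 𝓘(ℂ, ℂ × ℂ) ω S) (G : TangentField S),
      T2Space S ∧ SecondCountableTopology S ∧ ConnectedSpace S ∧
      IsFoliationOn G Set.univ ∧ Nonempty (Realization l G) := by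
  obtain ⟨R, hR, htrans⟩ := l.orbit
  obtain ⟨-, -, -, -, -, -, -, -, n, K, hn, -, hK, -, hD⟩ := l.prepared
  obtain ⟨hRa, hR1, hR2, hR', a, B, ha, hB, hU, hRB⟩ := hR
  have hb : 0 < ‖(R 0).2‖ := norm_pos_iff.2 hR2
  have hUb : adaptedRegion lam a ‖(R 0).2‖ ⊆ l.U := (adaptedRegion_mono le_rfl hRB).trans hU
  have hRA : R 0 ∈ adaptedRegion lam (a / 2) ‖(R 0).2‖ := by
    refine ⟨?_, ?_, le_rfl⟩
    · rw [hR1, norm_zero, Real.zero_rpow hlam.ne', mul_zero]; positivity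
    · rw [hR1, norm_zero]; exact zero_le_one
  have h1A : ((1, 0) : ℂ × ℂ) ∈ adaptedRegion lam (a / 2) ‖(R 0).2‖ := by
    refine ⟨?_, ?_, ?_⟩
    · simp; positivity
    · simp
    · simp
  have hAa : adaptedRegion lam (a / 2) ‖(R 0).2‖ ⊆ adaptedRegion lam a ‖(R 0).2‖ :=
    adaptedRegion_mono (by linarith) le_rfl
  obtain ⟨φ₁, ρ₁, hρ₁, hs₁, ht₁, hd₁, hds₁, h0₁, hx, hH₁⟩ :=
    exists_flowBox_horizontal l.isOpen hK hD (hUb (hAa h1A))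
  obtain ⟨φ₂, ρ₂, hρ₂, hs₂, ht₂, hd₂, hds₂, h0₂, hy, hH₂⟩ :=
    exists_flowBox_vertical hlam hn l.isOpen hK hD hRa hR1 hR2 hR' (hUb (hAa hRA))
  set ρ := min ρ₁ ρ₂ with hρdef
  have hρ : 0 < ρ := lt_min hρ₁ hρ₂
  have hballs₁ : Metric.ball (0 : ℂ × ℂ) ρ ⊆ Metric.ball 0 ρ₁ :=
    Metric.ball_subset_ball (min_le_left _ _)
  have hballs₂ : Metric.ball (0 : ℂ × ℂ) ρ ⊆ Metric.ball 0 ρ₂ :=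
    Metric.ball_subset_ball (min_le_right _ _)
  obtain ⟨η, hη, hηρ, hWU⟩ := exists_saddleDomain_subset hlam hb l.isOpen hUb
    (c := ρ / 8) (by positivity)
  set W := saddleDomain lam a ‖(R 0).2‖ η with hWdef
  have hW : IsOpen W := isOpen_saddleDomain hlam
  have hAW : adaptedRegion lam (a / 2) ‖(R 0).2‖ ⊆ W :=
    adaptedRegion_subset_saddleDomain (by linarith) hb hη
  have hDW : IsFoliationOn l.fol W :=
    isFoliationOn_prepared hlam hn hW (hK.mono hWU) fun p hp => hD p (hWU hp)
  -- both transversals lie in `W`, and `R` is close to its base point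
  have hsmall : ∀ᶠ z in 𝓝 (0 : ℂ), ((1, z) : ℂ × ℂ) ∈ W ∧ R z ∈ W ∧
      ‖(R z).2 - (R 0).2‖ < ‖(R 0).2‖ * (ρ / 8) := by
    refine Filter.Eventually.and ?_ (Filter.Eventually.and ?_ ?_)
    · have : ContinuousAt (fun z : ℂ => ((1 : ℂ), z)) 0 := by fun_prop
      exact this.eventually (hW.mem_nhds (hAW h1A))
    · exact hRa.continuousAt.eventually (hW.mem_nhds (hAW hRA))
    · have : ContinuousAt (fun z : ℂ => ‖(R z).2 - (R 0).2‖) 0 :=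
        (hRa.continuousAt.snd.sub continuousAt_const).norm
      refine this.eventually_lt_const ?_
      change ‖(R 0).2 - (R 0).2‖ < _
      rw [sub_self, norm_zero]
      positivity
  obtain ⟨ρ'', hρ'', hsm⟩ := Metric.eventually_nhds_iff_ball.1 hsmall
  set ρ' := min ρ ρ'' with hρ'def
  have hρ' : 0 < ρ' := lt_min hρ hρ''
  have hsm' : ∀ z : ℂ, ‖z‖ < ρ' → ((1, z) : ℂ × ℂ) ∈ W ∧ R z ∈ W ∧
      ‖(R z).2 - (R 0).2‖ < ‖(R 0).2‖ * (ρ / 8) := fun z hz =>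
    hsm z (mem_ball_zero_iff.2 (hz.trans_le (min_le_right _ _)))
  obtain ⟨τ, hτs, hτt, hτ, hτ', hτH, hτ₁, hτ₂, hsep⟩ := exists_tubeGluing (D := l.fol) (W := W) hW
    (ρ := ρ) (ρ' := ρ') (min_le_left _ _) (R := R) (hs₁ ▸ hballs₁) (hs₂ ▸ hballs₂)
    (Set.disjoint_left.2 fun p h h' => by
      have h1 := (ht₁ h).2
      have h2 := (ht₂ h').2
      have h3 : ‖(1 : ℂ)‖ ≤ ‖p.1‖ + ‖p.1 - 1‖ := by
        have : (1 : ℂ) = p.1 - (p.1 - 1) := by ring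
        calc ‖(1 : ℂ)‖ = ‖p.1 - (p.1 - 1)‖ := by rw [← this]
          _ ≤ _ := norm_sub_le _ _
      rw [norm_one] at h3
      linarith)
    hd₁ hd₂ hds₁ hds₂ (fun w hw => hx w (hballs₁ hw)) (fun w hw => hy w (hballs₂ hw)) hH₁ hH₂
    (fun p hp => hp.1.trans_le (by linarith))
    (fun p hp => hp.2.1.trans_le (by gcongr)) (fun z hz => (hsm' z hz).2.2.le)
  have hstart : ∀ z : ℂ, ‖z‖ < ρ' → (0, z) ∈ τ.source ∧ τ (0, z) = (1, z) := fun z hz => by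
    have h1 : φ₁ (0, z) = (1, z) := h0₁ z (mem_ball_zero_iff.2
      (hz.trans_le ((min_le_left _ _).trans (min_le_left _ _))))
    have h2 := hτ₁ (0, z) ⟨by simp; positivity, by simp; positivity, by simp; positivity, hz⟩
      (by simp; positivity) (by rw [h1]; exact (hsm' z hz).1)
    rwa [h1] at h2
  have hend : ∀ z : ℂ, ‖z‖ < ρ' → ((ρ : ℂ), z) ∈ τ.source ∧ τ ((ρ : ℂ), z) = R z := fun z hz => by
    have h1 : φ₂ (tubeReflection ρ ((ρ : ℂ), z)) = R z := by
      rw [tubeReflection_apply, sub_self]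
      exact h0₂ z (mem_ball_zero_iff.2
        (hz.trans_le ((min_le_left _ _).trans (min_le_right _ _))))
    have h2 := hτ₂ ((ρ : ℂ), z) ⟨by rw [Complex.ofReal_re]; linarith,
      by rw [Complex.ofReal_re]; linarith, by rw [Complex.ofReal_im, abs_zero]; positivity, hz⟩
      (by rw [Complex.ofReal_re]; linarith) (by rw [h1]; exact (hsm' z hz).2.1)
    rwa [h1] at h2
  have hz0 : ‖(0 : ℂ)‖ < ρ' := by simpa using hρ'
  obtain ⟨S, _, _, hS, G, e₁, e₂, hT2, hSC, hconn, hGf, hes₁, hes₂, he₁, hglue, hGmap, hGH⟩ :=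
    exists_glued_surface hDW (isOpen_tube ρ ρ') (isConnected_saddleDomain hlam ha hb hη)
      (isConnected_tube hρ hρ') τ ⟨_, (hstart 0 hz0).1⟩ hτs hτt hτ hτ' hτH hsep
  obtain ⟨γ, hγ⟩ := holonomyTransports_tube hρ hρ' hes₂ hGH
    (f := fun z => e₁ (1, z)) (g := fun z => e₁ (R z))
    (fun z hz => by rw [hglue _ (hstart z hz).1, (hstart z hz).2])
    (fun z hz => by rw [hglue _ (hend z hz).1, (hend z hz).2])
  have hR0 : R 0 ∈ φ₂.target := by
    rw [← h0₂ 0 (Metric.mem_ball_self hρ₂)]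
    exact φ₂.map_source (hs₂ ▸ Metric.mem_ball_self hρ₂)
  refine ⟨S, _, _, hS, G, hT2, hSC, hconn, hGf, ⟨?_⟩⟩
  exact
    { W := W
      isOpen := hW
      disk_subset := fun p hp => hAW ⟨by rw [hp.2, norm_zero, zero_mul]; positivity, hp.1,
        by rw [hp.2, norm_zero]; exact hb.le⟩
      vertical := isSimplyConnected_saddleDomain_vertical hlam ha hb hη
      horizontal := isSimplyConnected_saddleDomain_horizontal ha hb hη
      fol := l.fol
      isFoliation := hDW
      R := R
      mem_trans := by
        rw [htrans]
        exact ⟨⟨hRa, hR1, hR2, hR', a, B, ha, hB, hU, hRB⟩, Path.refl _,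
          holonomyTransports_refl φ₂.open_target (fun p hp => (ht₂ hp).1) hH₂ hRa hR0⟩
      extends_germ := ⟨a / 2, ‖(R 0).2‖, by positivity, hb,
        fun p hp => ⟨hUb (hAa hp), hAW hp⟩, fun _ _ => rfl, hRA⟩
      Ψ := e₁
      source_eq := hes₁
      biholomorphic := he₁
      map_fol := hGmap
      γ := γ
      holonomy := hγ }

end SaddleLoop

end

theorem mainTheorem10 (lam : ℝ) (hlam : 0 < lam) (L : SaddleLoop.LoopGerm lam) :
    ∃ (S : Type) (_ : TopologicalSpace S) (_ : ChartedSpace (ℂ × ℂ) S)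
      (_ : IsManifold 𝓘(ℂ, ℂ × ℂ) ω S) (G : SaddleLoop.TangentField S),
      T2Space S ∧ SecondCountableTopology S ∧ ConnectedSpace S ∧
      SaddleLoop.IsFoliationOn G Set.univ ∧ SaddleLoop.IsRealizedIn L G := by
  induction L using Quotient.inductionOn with | h l => ?_
  obtain ⟨S, i₁, i₂, hS, G, h₁, h₂, h₃, h₄, h₅⟩ := SaddleLoop.exists_realization hlam l
  exact ⟨S, i₁, i₂, hS, G, h₁, h₂, h₃, h₄, l, rfl, h₅⟩
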